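/- Let $\Omega\subseteq\mathbb{R}^2$ be compact and let $\mathcal{B}_\Omega$ be the space of all $f\in L^2(\mathbb{R}^2)$ whose Fourier transform vanishes almost everywhere outside $\Omega$; each $f\in\mathcal{B}_\Omega$ is identified with its continuous representative. A set $\Lambda\subseteq\mathbb{R}^2$ is a set of stable sampling for $\mathcal{B}_\Omega$ if there are constants $A,B>0$ with $A\|f\|_2^2\le\sum_{\lambda\in\Lambda}|f(\lambda)|^2\le B\|f\|_2^2$ for all $f\in\mathcal{B}_\Omega$. A trajectory set $P$ is a countable family of continuous curves $\gamma_i:\mathbb{R}\to\mathbb{R}^2$, each rectifiable on every bounded interval. Let $\bigcup P$ denote the set of all points on its curves. For $a>0$ and $x\in\mathbb{R}^2$ let $\mathcal{M}^P(a,x)$ be the sum over $i$ of the arc lengths of the parts of the curves $\gamma_i$ that lie in the closed Euclidean ball $B_a(x)$ (arc length is that of the curve, so pieces traversed repeatedly are counted repeatedly). The upper path density of $P$ is $$\ell^+(P)=\limsup_{a\to\infty}\ \sup_{x\in\mathbb{R}^2}\frac{\mathcal{M}^P(a,x)}{|B_a(0)|}\in[0,\infty].$$ Let $\mathrm{Nyq}_\Omega$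 be the collection of stable Nyquist trajectory sets for $\mathcal{B}_\Omega$, that is, of all trajectory sets $P$ such that 1. there is a uniformly discrete set $\Lambda\subseteq\bigcup P$ (i.e. for some $r>0$ any two distinct points of $\Lambda$ have distance greater than $r$) which is a set of stable sampling for $\mathcal{B}_\Omega$; and 2. there are a function $\delta\ge 0$ with $\delta(a)=o(a^2)$ as $a\to\infty$ and an $a_0$ such that for all $a\ge a_0$ and all $x\in\mathbb{R}^2$ there is a rectifiable curve $\alpha:[0,1]\to\mathbb{R}^2$ of length $\mathcal{M}^P(a,x)+\delta(a)$ with $\bigcup P\cap B_a(x)\subseteq\alpha([0,1])$. Then for every $\varepsilon>0$ there is a $P\in\mathrm{Nyq}_\Omega$ with $\ell^+(P)<\varepsilon$. Consequently $$\inf_{P\in\mathrm{Nyq}_\Omega}\ell^+(P)=0.$$ -/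

import Mathlib

open MeasureTheory Filter Asymptotics
open scoped ENNReal NNReal FourierTransform

namespace MobileSampling

/-- The Euclidean space `ℝᵈ`. -/
abbrev Euc (d : ℕ) : Type := EuclideanSpace ℝ (Fin d)

/-! ### Bandlimited functions and stable sampling -/

/-- The space of square-integrable functions `f` on `ℝᵈ` whose (`L²`) Fourier transform vanishes
almost everywhere outside `Ω`. An element is represented by its continuous version, so that point
evaluations `f x` make sense; for compact `Ω` every class in `L²` with Fourier transform vanishing
a.e. outside `Ω` has exactly one continuous version. -/
def Bandlimited {d : ℕ} (Ω : Set (Euc d)) : Set (Euc d → ℂ) :=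
  {f | Continuous f ∧ ∃ hf : MemLp f 2 (volume : Measure (Euc d)),
    ∀ᵐ ω : Euc d, ω ∉ Ω → (𝓕 (hf.toLp f) : Lp ℂ 2 (volume : Measure (Euc d))) ω = 0}

/-- `Λ` is a set of stable sampling for the functions bandlimited to `Ω`: for some `A, B > 0`,
`A ‖f‖² ≤ ∑_{x ∈ Λ} |f x|² ≤ B ‖f‖²` for all such `f`. -/
def IsStableSampling {d : ℕ} (Ω Λ : Set (Euc d)) : Prop :=
  ∃ A B : ℝ, 0 < A ∧ 0 < B ∧ ∀ f ∈ Bandlimited Ω,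
    ENNReal.ofReal A * eLpNorm f 2 volume ^ 2 ≤ ∑' x : Λ, ‖f x‖ₑ ^ 2 ∧
    ∑' x : Λ, ‖f x‖ₑ ^ 2 ≤ ENNReal.ofReal B * eLpNorm f 2 volume ^ 2

/-- `Λ` is uniformly discrete (separated). -/
def UniformlyDiscrete {d : ℕ} (Λ : Set (Euc d)) : Prop :=
  ∃ r : ℝ, 0 < r ∧ ∀ x ∈ Λ, ∀ y ∈ Λ, x ≠ y → r < dist x y

/-! ### Trajectory sets and path density -/

/-- A trajectory set: a countable family of continuous curves `ℝ → ℝᵈ`, each rectifiable on every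
bounded interval. The trajectories are given together with a parametrization. -/
structure TrajectorySet (d : ℕ) where
  /-- the index set -/
  ι : Type
  countable : Countable ι
  /-- the parametrizations of the trajectories -/
  curve : ι → ℝ → Euc d
  continuous : ∀ i, Continuous (curve i)
  rectifiable : ∀ i, ∀ a b : ℝ, eVariationOn (curve i) (Set.Icc a b) ≠ ⊤

/-- The set of points lying on the trajectories of `P`. -/
def TrajectorySet.points {d : ℕ} (P : TrajectorySet d) : Set (Euc d) :=
  ⋃ i, Set.range (P.curve i)

/-- The signed arc length of `γ` between the parameters `0` and `t`
(arc length being the supremum of the lengths of inscribed polygons). -/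
noncomputable def arcLengthParam {d : ℕ} (γ : ℝ → Euc d) (t : ℝ) : ℝ :=
  variationOnFromTo γ Set.univ 0 t

/-- The arc length of the part of the curve `γ` that lies in `S`: the Lebesgue measure of the set of
those values of the arc length parameter for which the curve is in `S`. If `S` contains
`γ '' [a, b]`, the interval `[a, b]` contributes exactly the variation of `γ` on `[a, b]`. -/
noncomputable def arcLengthIn {d : ℕ} (γ : ℝ → Euc d) (S : Set (Euc d)) : ℝ≥0∞ :=
  volume (arcLengthParam γ '' (γ ⁻¹' S))

/-- The total arc length of the trajectories of `P` in the closed ball of radius `a` about `x`. -/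
noncomputable def TrajectorySet.lengthInBall {d : ℕ} (P : TrajectorySet d) (a : ℝ) (x : Euc d) :
    ℝ≥0∞ :=
  ∑' i, arcLengthIn (P.curve i) (Metric.closedBall x a)

/-- The upper path density. -/
noncomputable def TrajectorySet.upperPathDensity {d : ℕ} (P : TrajectorySet d) : ℝ≥0∞ :=
  limsup (fun a : ℝ => ⨆ x : Euc d,
    P.lengthInBall a x / volume (Metric.closedBall (0 : Euc d) a)) atTop

/-- The non-degeneracy condition: for some `δ(a) = o(aᵈ)`, independent of `x`, and all large `a`,
the part of `P` in each ball of radius `a` is covered by a single rectifiable curve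
`α : [0,1] → ℝᵈ` whose length is the length of `P` in the ball plus `δ(a)`. -/
def TrajectorySet.NonDegenerate {d : ℕ} (P : TrajectorySet d) : Prop :=
  ∃ δ : ℝ → ℝ≥0, (fun a => (δ a : ℝ)) =o[atTop] (fun a : ℝ => a ^ d) ∧
    ∃ a₀ : ℝ, ∀ a : ℝ, a₀ ≤ a → ∀ x : Euc d, ∃ α : ℝ → Euc d,
      ContinuousOn α (Set.Icc 0 1) ∧
      eVariationOn α (Set.Icc 0 1) ≠ ⊤ ∧
      eVariationOn α (Set.Icc 0 1) = P.lengthInBall a x + δ a ∧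
      P.points ∩ Metric.closedBall x a ⊆ α '' Set.Icc 0 1

/-- The stable Nyquist trajectory sets for the functions bandlimited to `Ω`. -/
def Nyq {d : ℕ} (Ω : Set (Euc d)) : Set (TrajectorySet d) :=
  {P | (∃ Λ : Set (Euc d), Λ ⊆ P.points ∧ UniformlyDiscrete Λ ∧ IsStableSampling Ω Λ) ∧
    P.NonDegenerate}

end MobileSampling

/-! Path density counts length, not samples, and a great many samples crowded into a tiny cluster
cost almost no length. One cluster of nodes is therefore placed near each point of `L ℤ²` with `L`
large, and one curve runs along each row of clusters. The curves are 3-Lipschitz and their rows are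
`L` apart, so the density is at most `84 / L`, no matter how many nodes a cluster has.

Sampling: for `u` in a cube of half-side `L` and bounded frequency, a plane wave is uniformly close
to a truncated Taylor series. There each power of `iθ` may be replaced by the same power of the
difference quotient `(exp (iηθ) - 1) / η`, a combination of values at the nodes `0, η, …, Kη`. The
degree `K` depends on `L`, the band and the tolerance, but not on `η` (`exists_planeWave_approx`).
Hence `f (Ln + u)` is a combination of the samples in the `n`-th cluster, plus the integral of the
spectrum against a small multiplier. Bessel's inequality sums these errors over `n`, and integration
over `u` gives `‖f‖² ≤ C * samples + ‖f‖² / 2` (`Bandlimited.eLpNorm_sq_le_of_approx`). The constant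
may be huge for small `η`, but stability only asks that it be finite. Bessel's inequality applied to
each node separately gives the upper sampling bound.

Geometry: as `K` is fixed before the mesh `1 / q`, the clusters can be made so small that a
Lipschitz curve visits every node of a row while staying within bounded distance of a horizontal
line (`exists_nearHorizontal_sampleSet_subset`).

Non-degeneracy: the rows meeting a ball are traversed back and forth (`NearHorizontal.exists_tour`).
Each of the `O(a)` rows costs an excess of `O(√a)`, partly from leaving the ball and partly from
joining adjacent chords, so the total excess is `O(a^(3/2)) = o(a²)`. -/

namespace MobileSampling

open scoped RealInnerProductSpace
open SchwartzMap

/-! ### Plane waves and the spectral representation of bandlimited functions -/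

/-- The plane wave `ω ↦ exp (2πi ⟨ω, x⟩)`. -/
noncomputable def planeWave {d : ℕ} (x ω : Euc d) : ℂ :=
  Complex.exp ((2 * Real.pi * ⟪ω, x⟫ : ℝ) * Complex.I)

lemma norm_planeWave {d : ℕ} (x ω : Euc d) : ‖planeWave x ω‖ = 1 :=
  Complex.norm_exp_ofReal_mul_I _

lemma planeWave_add {d : ℕ} (x y ω : Euc d) :
    planeWave (x + y) ω = planeWave x ω * planeWave y ω := by
  simp only [planeWave, inner_add_right, ← Complex.exp_add]
  push_cast
  ring_nf

lemma continuous_planeWave_right {d : ℕ} (x : Euc d) : Continuous (planeWave x) := by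
  unfold planeWave
  fun_prop

/-- The integral formula for the inverse Fourier transform on `L¹ ∩ L²`. -/
lemma fourierInv_toLp_ae_eq {d : ℕ} (F : Lp ℂ 2 (volume : Measure (Euc d)))
    (hF : Integrable F) :
    ((𝓕⁻ F : Lp ℂ 2 (volume : Measure (Euc d))) : Euc d → ℂ) =ᵐ[volume]
      𝓕⁻ (F : Euc d → ℂ) := by
  have hc : Continuous (𝓕⁻ (F : Euc d → ℂ)) :=
    VectorFourier.fourierIntegral_continuous Real.continuous_fourierChar
      (by simp only [LinearMap.neg_apply, innerₗ_apply_apply]; fun_prop) hF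
  -- Both sides are tested against smooth compactly supported functions. The `L²` transform agrees
  -- with the distributional one, and the integral transform obeys the multiplication formula by
  -- Fubini.
  refine ae_eq_of_integral_contDiff_smul_eq ((Lp.memLp _).locallyIntegrable (by norm_num))
    hc.locallyIntegrable ?_
  intro g hg hgc
  have hg₁ : HasCompactSupport (Complex.ofRealCLM ∘ g) := hgc.comp_left rfl
  have hg₂ : ContDiff ℝ ((⊤ : ℕ∞) : WithTop ℕ∞) (Complex.ofRealCLM ∘ g) := by fun_prop
  let φ : 𝓢(Euc d, ℂ) := hg₁.toSchwartzMap hg₂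
  have h1 := congrArg (fun T => T φ) (Lp.fourierInv_toTemperedDistribution_eq F)
  simp only [TemperedDistribution.fourierInv_apply, Lp.toTemperedDistribution_apply] at h1
  have h2 := VectorFourier.integral_fourierIntegral_smul_eq_flip (μ := volume) (ν := volume)
    (e := Real.fourierChar) (L := -innerₗ (Euc d)) (f := φ) (g := (F : Euc d → ℂ))
    Real.continuous_fourierChar
    (by simp only [LinearMap.neg_apply, innerₗ_apply_apply]; fun_prop)
    (φ.integrable) hF
  have h3 : (-innerₗ (Euc d)).flip = -innerₗ (Euc d) := by
    ext x y
    simp [real_inner_comm]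
  rw [h3] at h2
  have h4 : ∀ x, φ x = (g x : ℂ) := fun x => rfl
  calc ∫ x, g x • (𝓕⁻ F : Lp ℂ 2 (volume : Measure (Euc d))) x
      = ∫ x, φ x • (𝓕⁻ F : Lp ℂ 2 (volume : Measure (Euc d))) x := by simp [h4]
    _ = ∫ x, (𝓕⁻ φ) x • F x := h1.symm
    _ = ∫ x, φ x • 𝓕⁻ (F : Euc d → ℂ) x := by
      rw [SchwartzMap.fourierInv_coe]
      exact h2
    _ = _ := by simp [h4]

/-- A bandlimited function is the trigonometric integral of its spectrum. -/
lemma Bandlimited.exists_spectrum {d : ℕ} {Ω : Set (Euc d)} (hΩ : IsCompact Ω) {f : Euc d → ℂ}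
    (hf : f ∈ Bandlimited Ω) :
    ∃ F : Euc d → ℂ, MemLp F 2 volume ∧ (∀ᵐ ω, ω ∉ Ω → F ω = 0) ∧
      eLpNorm F 2 volume = eLpNorm f 2 volume ∧
      ∀ x, f x = ∫ ω in Ω, F ω * planeWave x ω := by
  obtain ⟨hfc, hf2, hfΩ⟩ := hf
  set F : Lp ℂ 2 (volume : Measure (Euc d)) := 𝓕 (hf2.toLp f) with hFdef
  -- On a set of finite measure `L²` is contained in `L¹`, so compactness of the spectrum makes the
  -- integral formula available.
  have hFint : Integrable F := by
    have : IsFiniteMeasure (volume.restrict Ω) := isFiniteMeasure_restrict.2 hΩ.measure_lt_top.ne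
    have h1 : IntegrableOn F Ω := ((Lp.memLp F).restrict Ω).integrable (by norm_num)
    rw [← integrable_indicator_iff hΩ.measurableSet] at h1
    refine h1.congr ?_
    filter_upwards [hfΩ] with ω hω
    by_cases h : ω ∈ Ω
    · simp [h]
    · simp [h, hω h]
  refine ⟨F, Lp.memLp F, hfΩ, ?_, ?_⟩
  · have h1 : ‖F‖ = ‖hf2.toLp f‖ := Lp.norm_fourier_eq _
    rw [Lp.norm_def, Lp.norm_def] at h1
    rw [(ENNReal.toReal_eq_toReal_iff' (Lp.eLpNorm_ne_top _) (Lp.eLpNorm_ne_top _)).1 h1]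
    exact eLpNorm_congr_ae hf2.coeFn_toLp
  · have hc : Continuous (𝓕⁻ (F : Euc d → ℂ)) :=
      VectorFourier.fourierIntegral_continuous Real.continuous_fourierChar
        (by simp only [LinearMap.neg_apply, innerₗ_apply_apply]; fun_prop) hFint
    have h1 : f =ᵐ[volume] 𝓕⁻ (F : Euc d → ℂ) := by
      refine hf2.coeFn_toLp.symm.trans ?_
      have := fourierInv_toLp_ae_eq F hFint
      rwa [hFdef, FourierPair.fourierInv_fourier_eq] at this
    -- Continuity of both sides upgrades equality almost everywhere to equality at every point,
    -- which sampling requires.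
    have h2 := (hfc.ae_eq_iff_eq volume hc).1 h1
    intro x
    rw [h2, Real.fourierInv_eq', setIntegral_eq_integral_of_ae_compl_eq_zero]
    · simp [planeWave, mul_comm]
    · filter_upwards [hfΩ] with ω hω h
      simp [hω h]

/-! ### Bessel's inequality for lattice exponentials on a cube -/

/-- The closed cube of side length `2 W` centred at the origin. -/
def cube (d : ℕ) (W : ℝ) : Set (Euc d) := {ω | ∀ i, ω i ∈ Set.Icc (-W) W}

/-- The point of `L ℤᵈ` with index `n`. -/
noncomputable def latticePoint {d : ℕ} (L : ℝ) (n : Fin d → ℤ) : Euc d :=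
  WithLp.toLp 2 fun i => L * n i

@[simp] lemma latticePoint_apply {d : ℕ} (L : ℝ) (n : Fin d → ℤ) (i : Fin d) :
    latticePoint L n i = L * n i := rfl

lemma cube_eq_preimage (d : ℕ) (W : ℝ) :
    cube d W = (MeasurableEquiv.toLp 2 (Fin d → ℝ)).symm ⁻¹'
      (Set.univ.pi fun _ => Set.Icc (-W) W) := by
  ext ω
  simp [cube, Pi.le_def, forall_and]

lemma measurableSet_cube (d : ℕ) (W : ℝ) : MeasurableSet (cube d W) := by
  rw [cube_eq_preimage]
  exact (MeasurableEquiv.measurable _) (MeasurableSet.univ_pi fun _ => measurableSet_Icc)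

lemma setIntegral_cube_prod (d : ℕ) (W : ℝ) (g : Fin d → ℝ → ℂ) :
    ∫ ω in cube d W, ∏ i, g i (ω i) = ∏ i, ∫ t in Set.Icc (-W) W, g i t := by
  have h := (EuclideanSpace.volume_preserving_symm_measurableEquiv_toLp (Fin d)).setIntegral_preimage_emb
    (MeasurableEquiv.measurableEmbedding _) (fun ω : Fin d → ℝ => ∏ i, g i (ω i))
    (Set.univ.pi fun _ => Set.Icc (-W) W)
  rw [cube_eq_preimage]
  refine Eq.trans h ?_
  rw [volume_pi, Measure.restrict_pi_pi, integral_fintype_prod_eq_prod]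

lemma volume_cube (d : ℕ) {W : ℝ} (hW : 0 ≤ W) :
    volume (cube d W) = ENNReal.ofReal ((2 * W) ^ d) := by
  rw [cube_eq_preimage,
    (EuclideanSpace.volume_preserving_symm_measurableEquiv_toLp (Fin d)).measure_preimage_equiv,
    volume_pi_pi]
  simp only [Real.volume_Icc, Finset.prod_const, Finset.card_univ, Fintype.card_fin]
  rw [ENNReal.ofReal_pow (by linarith)]
  ring_nf

/-- Characters of a period of the interval integrate to zero. -/
lemma integral_Icc_exp_int {W : ℝ} (hW : 0 ≤ W) {a : ℝ} (ha : a ≠ 0) {k : ℤ}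
    (hk : 2 * a * W = k) :
    ∫ t in Set.Icc (-W) W, Complex.exp ((2 * Real.pi * (t * a) : ℝ) * Complex.I) = 0 := by
  rw [integral_Icc_eq_integral_Ioc, ← intervalIntegral.integral_of_le (by linarith)]
  have hc : (2 * Real.pi * a * Complex.I : ℂ) ≠ 0 := by
    simp [Real.pi_ne_zero, ha]
  have h : ∀ t : ℝ, Complex.exp ((2 * Real.pi * (t * a) : ℝ) * Complex.I)
      = Complex.exp ((2 * Real.pi * a * Complex.I) * t) := by
    intro t; push_cast; ring_nf
  simp_rw [h]
  rw [integral_exp_mul_complex hc]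
  have h2 : Complex.exp (2 * Real.pi * a * Complex.I * W) =
      Complex.exp (2 * Real.pi * a * Complex.I * ((-W : ℝ) : ℂ)) := by
    rw [Complex.exp_eq_exp_iff_exists_int]
    refine ⟨k, ?_⟩
    have : (k : ℂ) = 2 * a * W := by exact_mod_cast hk.symm
    rw [this]; push_cast; ring
  rw [h2, sub_self, zero_div]

/-- Orthogonality comes from the integrality of both `L` and `W`: each coordinate runs over an
interval of length `2W`, which contains the whole number `2 W L nᵢ` of periods. -/
lemma setIntegral_cube_planeWave {d : ℕ} {L W : ℕ} (hL : 0 < L) (n : Fin d → ℤ) :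
    ∫ ω in cube d W, planeWave (latticePoint L n) ω = if n = 0 then ((2 * W) ^ d : ℂ) else 0 := by
  have h : ∀ ω : Euc d, planeWave (latticePoint L n) ω =
      ∏ i, Complex.exp ((2 * Real.pi * (ω i * (L * n i)) : ℝ) * Complex.I) := by
    intro ω
    rw [← Complex.exp_sum, planeWave, PiLp.inner_apply]
    congr 1
    push_cast
    rw [Finset.mul_sum, Finset.sum_mul]
    refine Finset.sum_congr rfl fun i _ => ?_
    simp
    ring
  simp_rw [h]
  rw [setIntegral_cube_prod d W fun i t =>
    Complex.exp ((2 * Real.pi * (t * (L * n i)) : ℝ) * Complex.I)]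
  split_ifs with hn
  · subst hn
    have : (volume.real (Set.Icc (-(W:ℝ)) W)) = 2 * W := by
      rw [Real.volume_real_Icc_of_le (by linarith [(Nat.cast_nonneg W : (0:ℝ) ≤ W)])]; ring
    simp [this]
  · obtain ⟨i, hi⟩ := Function.ne_iff.1 hn
    refine Finset.prod_eq_zero (Finset.mem_univ i) ?_
    have hi' : (n i : ℝ) ≠ 0 := by exact_mod_cast hi
    refine integral_Icc_exp_int (Nat.cast_nonneg W) (k := 2 * (L * n i) * W)
      (mul_ne_zero (by positivity) hi') (by push_cast; ring)

lemma conj_planeWave {d : ℕ} (x ω : Euc d) :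
    (starRingEnd ℂ) (planeWave x ω) = planeWave (-x) ω := by
  rw [planeWave, ← Complex.exp_conj, planeWave]
  simp [Complex.conj_ofNat]

lemma latticePoint_neg {d : ℕ} (L : ℝ) (n : Fin d → ℤ) :
    latticePoint L (-n) = -latticePoint L n := by
  ext i; simp

lemma latticePoint_add {d : ℕ} (L : ℝ) (n m : Fin d → ℤ) :
    latticePoint L (n + m) = latticePoint L n + latticePoint L m := by
  ext i; simp [mul_add]

lemma memLp_planeWave {d : ℕ} (W : ℕ) (x : Euc d) :
    MemLp (planeWave x) 2 (volume.restrict (cube d W)) := by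
  have : IsFiniteMeasure (volume.restrict (cube d W)) :=
    isFiniteMeasure_restrict.2 (by rw [volume_cube _ (Nat.cast_nonneg W)]; exact ENNReal.ofReal_ne_top)
  exact MemLp.of_bound (continuous_planeWave_right x).aestronglyMeasurable 1
    (Eventually.of_forall fun ω => (norm_planeWave x ω).le)

/-- Bessel's inequality for the exponentials with frequencies in `L ℤᵈ` on a cube. -/
lemma tsum_integral_planeWave_le {d : ℕ} {L W : ℕ} (hL : 0 < L) (hW : 0 < W) {G : Euc d → ℂ}
    (hG : MemLp G 2 (volume.restrict (cube d W))) :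
    ∑' n : Fin d → ℤ, ‖∫ ω in cube d W, G ω * planeWave (latticePoint L n) ω‖ₑ ^ 2 ≤
      ENNReal.ofReal ((2 * W) ^ d) * eLpNorm G 2 (volume.restrict (cube d W)) ^ 2 := by
  set μ := volume.restrict (cube d (W : ℝ)) with hμ
  have hV : (0 : ℝ) < (2 * W) ^ d := by positivity
  set V : ℝ := (2 * W) ^ d with hVdef
  let e : (Fin d → ℤ) → Lp ℂ 2 μ := fun n => (memLp_planeWave W (latticePoint L n)).toLp
  have hinner : ∀ (n : Fin d → ℤ) (H : Euc d → ℂ) (hH : MemLp H 2 μ),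
      inner ℂ (e n) hH.toLp = ∫ ω, H ω * planeWave (latticePoint L (-n)) ω ∂μ := by
    intro n H hH
    rw [L2.inner_def]
    refine integral_congr_ae ?_
    filter_upwards [hH.coeFn_toLp, (memLp_planeWave W (latticePoint L n)).coeFn_toLp] with ω h1 h2
    rw [h1, show e n ω = _ from h2, RCLike.inner_apply, conj_planeWave, latticePoint_neg]
  have hee : ∀ n m, inner ℂ (e n) (e m) = if m = n then (V : ℂ) else 0 := by
    intro n m
    rw [hinner n _ (memLp_planeWave W (latticePoint L m))]
    simp_rw [← planeWave_add, ← latticePoint_add]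
    rw [setIntegral_cube_planeWave hL]
    simp [hVdef, ← sub_eq_add_neg, sub_eq_zero]
  have hs : (0 : ℝ) < Real.sqrt V := Real.sqrt_pos.2 hV
  have hss : Real.sqrt V * Real.sqrt V = V := Real.mul_self_sqrt hV.le
  let v : (Fin d → ℤ) → Lp ℂ 2 μ := fun n => ((Real.sqrt V : ℂ)⁻¹) • e n
  have hv : Orthonormal ℂ v := by
    rw [orthonormal_iff_ite]
    intro n m
    simp only [v, inner_smul_left, inner_smul_right, hee, map_inv₀, Complex.conj_ofReal]
    by_cases h : n = m
    · have : (Real.sqrt V : ℂ) ≠ 0 := by exact_mod_cast hs.ne'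
      simp only [h, if_true]
      field_simp
      rw [sq]; exact_mod_cast hss.symm
    · simp [h, Ne.symm h]
  have hb := hv.tsum_inner_products_le (x := hG.toLp)
  have hsum := hv.inner_products_summable (hG.toLp)
  have h1 : ∀ n, ENNReal.ofReal V * ENNReal.ofReal (‖inner ℂ (v n) hG.toLp‖ ^ 2) =
      ‖∫ ω, G ω * planeWave (latticePoint L (-n)) ω ∂μ‖ₑ ^ 2 := by
    intro n
    simp only [v, inner_smul_left, norm_mul, hinner n G hG]
    rw [← ENNReal.ofReal_mul hV.le, ← ofReal_norm, ← ENNReal.ofReal_pow (norm_nonneg _)]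
    congr 1
    simp only [map_inv₀, Complex.conj_ofReal, norm_inv, Complex.norm_real,
      Real.norm_of_nonneg hs.le, mul_pow, inv_pow, sq (Real.sqrt V), hss]
    field_simp
  -- The inner product conjugates its first argument and so produces the frequency `-n`; the sum is
  -- reindexed by negation.
  calc ∑' n : Fin d → ℤ, ‖∫ ω, G ω * planeWave (latticePoint L n) ω ∂μ‖ₑ ^ 2
      = ∑' n : Fin d → ℤ, ‖∫ ω, G ω * planeWave (latticePoint L (-n)) ω ∂μ‖ₑ ^ 2 :=
        ((Equiv.neg (Fin d → ℤ)).tsum_eq fun n =>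
          ‖∫ ω, G ω * planeWave (latticePoint L n) ω ∂μ‖ₑ ^ 2).symm
    _ = ENNReal.ofReal V * ∑' n, ENNReal.ofReal (‖inner ℂ (v n) hG.toLp‖ ^ 2) := by
        rw [← ENNReal.tsum_mul_left]
        exact tsum_congr fun n => (h1 n).symm
    _ ≤ _ := by
        gcongr
        rw [← ENNReal.ofReal_tsum_of_nonneg (fun _ => by positivity) hsum]
        refine (ENNReal.ofReal_le_ofReal hb).trans ?_
        rw [Lp.norm_toLp, ENNReal.ofReal_pow ENNReal.toReal_nonneg,
          ENNReal.ofReal_toReal hG.2.ne]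

/-! ### Approximating plane waves from their values on small clusters -/

lemma exists_taylor_exp_approx (M ε : ℝ) (hε : 0 < ε) :
    ∃ K : ℕ, ∀ z : ℂ, ‖z‖ ≤ M →
      ‖Complex.exp z - ∑ k ∈ Finset.range (K + 1), z ^ k / k.factorial‖ ≤ ε := by
  have h1 : Tendsto (fun n : ℕ => M ^ n / n.factorial) atTop (nhds 0) :=
    FloorSemiring.tendsto_pow_div_factorial_atTop M
  have h2 : ∀ᶠ n : ℕ in atTop, M ^ n / n.factorial < ε / 2 := h1.eventually_lt_const (by positivity)
  have h3 : ∀ᶠ n : ℕ in atTop, 2 * M ≤ n := (tendsto_natCast_atTop_atTop).eventually_ge_atTop _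
  obtain ⟨N, hN⟩ := eventually_atTop.1 (h2.and h3)
  refine ⟨N, fun z hz => ?_⟩
  obtain ⟨h4, h5⟩ := hN (N + 1) (Nat.le_succ N)
  have h6 : ‖z‖ / (N + 1).succ ≤ 1 / 2 := by
    rw [div_le_iff₀ (by positivity)]
    push_cast at h5 ⊢
    linarith
  -- The remainder is at most twice the first omitted term, hence the bound `ε / 2` demanded of that
  -- term.
  refine (Complex.exp_bound' h6).trans ?_
  have : ‖z‖ ^ (N + 1) / (N + 1).factorial ≤ M ^ (N + 1) / (N + 1).factorial := by gcongr
  linarith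

lemma norm_pow_sub_pow_le_mul {a b : ℂ} {M : ℝ} (ha : ‖a‖ ≤ M) (hb : ‖b‖ ≤ M) (k : ℕ) :
    ‖a ^ k - b ^ k‖ ≤ k * M ^ (k - 1) * ‖a - b‖ := by
  have hM : 0 ≤ M := (norm_nonneg a).trans ha
  rw [← Commute.geom_sum₂_mul (Commute.all a b), norm_mul]
  gcongr
  refine (norm_sum_le _ _).trans ?_
  calc ∑ i ∈ Finset.range k, ‖a ^ i * b ^ (k - 1 - i)‖
      ≤ ∑ i ∈ Finset.range k, M ^ (k - 1) := by
        refine Finset.sum_le_sum fun i hi => ?_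
        have : i ≤ k - 1 := by have := Finset.mem_range.1 hi; omega
        rw [norm_mul, norm_pow, norm_pow]
        calc ‖a‖ ^ i * ‖b‖ ^ (k - 1 - i) ≤ M ^ i * M ^ (k - 1 - i) := by gcongr
          _ = M ^ (k - 1) := by rw [← pow_add, Nat.add_sub_cancel' this]
    _ = k * M ^ (k - 1) := by simp

/-- The coefficient with which `exp (i j η θ)` enters the truncated Taylor series of
`exp (i t θ)` in powers of the difference quotient `(exp (i η θ) - 1) / η`. -/
noncomputable def interpCoeff (K : ℕ) (η : ℝ) (j : ℕ) (t : ℝ) : ℂ :=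
  ∑ k ∈ Finset.range (K + 1), (t : ℂ) ^ k / k.factorial * ((η : ℂ)⁻¹ ^ k * ((-1) ^ (k - j) * k.choose j))

lemma continuous_interpCoeff (K : ℕ) (η : ℝ) (j : ℕ) : Continuous (interpCoeff K η j) := by
  unfold interpCoeff
  fun_prop

/-- Binomial expansion of `(w - 1) ^ k`, with the two sums exchanged: a polynomial in the difference
quotient is a combination of the node values `w ^ j`. -/
lemma sum_interpCoeff (K : ℕ) (η t : ℝ) (w : ℂ) :
    ∑ j ∈ Finset.range (K + 1), interpCoeff K η j t * w ^ j =
      ∑ k ∈ Finset.range (K + 1), (t : ℂ) ^ k / k.factorial * ((w - 1) / η) ^ k := by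
  simp only [interpCoeff, Finset.sum_mul]
  rw [Finset.sum_comm]
  refine Finset.sum_congr rfl fun k hk => ?_
  have hk' : k + 1 ≤ K + 1 := Finset.mem_range.1 hk
  rw [div_eq_inv_mul (w - 1), mul_pow, sub_eq_add_neg, add_pow, Finset.mul_sum, Finset.mul_sum]
  symm
  rw [Finset.sum_subset (Finset.range_subset_range.2 hk')]
  · refine Finset.sum_congr rfl fun j _ => ?_
    ring
  · intro j _ hj
    -- For `j > k` the truncated exponent `k - j` is meaningless, but the binomial coefficient
    -- vanishes.
    rw [Nat.choose_eq_zero_of_lt (by simpa using hj)]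
    simp

/-- Exponentials of bounded frequency on a bounded interval are uniformly approximated from their
values at arbitrarily close equispaced nodes, the number of nodes being fixed in advance. -/
lemma exists_exp_approx (T R ε : ℝ) (hT : 0 ≤ T) (hR : 0 ≤ R) (hε : 0 < ε) :
    ∃ K : ℕ, ∃ η₀ : ℝ, 0 < η₀ ∧ ∀ η : ℝ, 0 < η → η ≤ η₀ →
      ∀ t : ℝ, |t| ≤ T → ∀ θ : ℝ, |θ| ≤ R →
        ‖Complex.exp ((θ * t : ℝ) * Complex.I) - ∑ j ∈ Finset.range (K + 1),
          interpCoeff K η j t * Complex.exp ((θ * (j * η) : ℝ) * Complex.I)‖ ≤ ε := by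
  -- Half of the error goes to Taylor truncation, which fixes `K` before `η` is considered. The
  -- other half goes to replacing `iθ` by its difference quotient.
  obtain ⟨K, hK⟩ := exists_taylor_exp_approx (R * T) (ε / 2) (by positivity)
  set M : ℝ := R + 1
  set B : ℝ := ∑ k ∈ Finset.range (K + 1), T ^ k / k.factorial * (k * M ^ (k - 1) * R ^ 2) with hB
  have hB0 : 0 ≤ B := Finset.sum_nonneg fun k _ => by positivity
  -- The first bound makes the total replacement error `η * B` at most `ε / 2`. The second keeps
  -- `|θ| η ≤ 1` and the difference quotient within `M = R + 1`.
  refine ⟨K, min ((ε / 2) / (B + 1)) (1 / (R + 1) ^ 2), by positivity, ?_⟩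
  intro η hη hη0 t ht θ hθ
  have hη1 : η * B ≤ ε / 2 := by
    have := hη0.trans (min_le_left _ _)
    rw [le_div_iff₀ (by positivity)] at this
    nlinarith
  have hη2 : η * (R + 1) ^ 2 ≤ 1 := by
    have := hη0.trans (min_le_right _ _)
    rwa [le_div_iff₀ (by positivity)] at this
  set w := Complex.exp ((θ * η : ℝ) * Complex.I) with hw
  have hwj : ∀ j : ℕ, Complex.exp ((θ * (j * η) : ℝ) * Complex.I) = w ^ j := by
    intro j
    rw [hw, ← Complex.exp_nat_mul]
    push_cast; ring_nf
  simp_rw [hwj]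
  rw [sum_interpCoeff]
  have hn1 : ‖((θ * t : ℝ) * Complex.I : ℂ)‖ ≤ R * T := by
    rw [norm_mul, Complex.norm_real, Complex.norm_I, mul_one, Real.norm_eq_abs, abs_mul]
    gcongr
  have htaylor := hK _ hn1
  have hθη : ‖((θ * η : ℝ) * Complex.I : ℂ)‖ = |θ| * η := by
    rw [norm_mul, Complex.norm_real, Complex.norm_I, mul_one, Real.norm_eq_abs, abs_mul,
      abs_of_pos hη]
  have hηc : (η : ℂ) ≠ 0 := by exact_mod_cast hη.ne'
  have hdiff : ‖(w - 1) / η - θ * Complex.I‖ ≤ η * R ^ 2 := by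
    have h1 : ‖((θ * η : ℝ) * Complex.I : ℂ)‖ ≤ 1 := by
      rw [hθη]
      nlinarith [abs_nonneg θ]
    have h2 := Complex.norm_exp_sub_one_sub_id_le h1
    have h3 : (w - 1) / η - θ * Complex.I = (w - 1 - (θ * η : ℝ) * Complex.I) / η := by
      field_simp; push_cast; ring
    rw [h3, norm_div, Complex.norm_real, Real.norm_of_nonneg hη.le, div_le_iff₀ hη]
    refine h2.trans ?_
    rw [hθη, mul_pow]
    have : |θ| ^ 2 ≤ R ^ 2 := by gcongr
    nlinarith [sq_nonneg η]
  have hb : ‖(θ * Complex.I : ℂ)‖ ≤ M := by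
    rw [norm_mul, Complex.norm_real, Complex.norm_I, mul_one, Real.norm_eq_abs]
    exact hθ.trans (by simp [M])
  have ha : ‖(w - 1) / η‖ ≤ M := by
    have h1 : ‖(θ * Complex.I : ℂ)‖ ≤ R := by
      rw [norm_mul, Complex.norm_real, Complex.norm_I, mul_one, Real.norm_eq_abs]
      exact hθ
    have h2 := norm_le_norm_add_norm_sub' ((w - 1) / η) (θ * Complex.I : ℂ)
    have : η * R ^ 2 ≤ 1 := by nlinarith
    simp only [M]; linarith
  have hsum : ‖∑ k ∈ Finset.range (K + 1), ((θ * t : ℝ) * Complex.I : ℂ) ^ k / k.factorial -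
      ∑ k ∈ Finset.range (K + 1), (t : ℂ) ^ k / k.factorial * ((w - 1) / η) ^ k‖ ≤ ε / 2 := by
    rw [← Finset.sum_sub_distrib]
    refine (norm_sum_le _ _).trans (le_trans (Finset.sum_le_sum (g := fun k : ℕ =>
      η * (T ^ k / k.factorial * (k * M ^ (k - 1) * R ^ 2))) fun k _ => ?_) ?_)
    · have h1 : ((θ * t : ℝ) * Complex.I : ℂ) ^ k / k.factorial -
          (t : ℂ) ^ k / k.factorial * ((w - 1) / η) ^ k =
          (t : ℂ) ^ k / k.factorial * ((θ * Complex.I) ^ k - ((w - 1) / η) ^ k) := by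
        push_cast; ring
      rw [h1, norm_mul, norm_div, norm_pow, Complex.norm_real, Real.norm_eq_abs,
        Complex.norm_natCast]
      have h2 := norm_pow_sub_pow_le_mul hb ha k
      rw [norm_sub_rev (θ * Complex.I : ℂ)] at h2
      calc |t| ^ k / k.factorial * ‖(θ * Complex.I : ℂ) ^ k - ((w - 1) / η) ^ k‖
          ≤ T ^ k / k.factorial * (k * M ^ (k - 1) * (η * R ^ 2)) := by
            gcongr
            refine h2.trans ?_
            gcongr
        _ = _ := by ring
    · rw [← Finset.mul_sum]; exact hη1
  calc _ ≤ _ := norm_sub_le_norm_sub_add_norm_sub _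
        (∑ k ∈ Finset.range (K + 1), ((θ * t : ℝ) * Complex.I : ℂ) ^ k / k.factorial) _
    _ ≤ ε := by linarith

/-- The nodes of a square cluster of mesh `η`. -/
noncomputable def clusterPoint (η : ℝ) (p : ℕ × ℕ) : Euc 2 := !₂[p.1 * η, p.2 * η]

/-- Plane waves with bounded frequency on a bounded square are uniformly approximated from their
values on arbitrarily small clusters of a fixed number of nodes. -/
lemma exists_planeWave_approx (T W ε : ℝ) (hT : 0 ≤ T) (hW : 0 ≤ W) (hε : 0 < ε) :
    ∃ K : ℕ, ∃ η₀ : ℝ, 0 < η₀ ∧ ∀ η : ℝ, 0 < η → η ≤ η₀ →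
      ∀ u : Euc 2, (∀ i, |u i| ≤ T) → ∀ ω ∈ cube 2 W,
        ‖planeWave u ω - ∑ p ∈ Finset.range (K + 1) ×ˢ Finset.range (K + 1),
          interpCoeff K η p.1 (u 0) * interpCoeff K η p.2 (u 1) *
            planeWave (clusterPoint η p) ω‖ ≤ ε := by
  -- With coordinate errors at most `δ = min 1 (ε / 3)`, the product of the two exponentials is off
  -- by at most `2δ + δ² ≤ 3δ ≤ ε`.
  obtain ⟨K, η₀, hη₀, h⟩ := exists_exp_approx T (2 * Real.pi * W) (min 1 (ε / 3)) hT
    (by positivity) (by positivity)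
  refine ⟨K, η₀, hη₀, fun η hη hη0 u hu ω hω => ?_⟩
  have hθ : ∀ i, |2 * Real.pi * ω i| ≤ 2 * Real.pi * W := by
    intro i
    rw [abs_mul, abs_of_pos Real.two_pi_pos]
    gcongr
    exact abs_le.2 (hω i)
  have hsplit : ∀ x y : ℝ, planeWave (!₂[x, y] : Euc 2) ω =
      Complex.exp ((2 * Real.pi * ω 0 * x : ℝ) * Complex.I) *
      Complex.exp ((2 * Real.pi * ω 1 * y : ℝ) * Complex.I) := by
    intro x y
    rw [planeWave, ← Complex.exp_add]
    simp only [PiLp.inner_apply, Fin.sum_univ_two]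
    simp
    ring_nf
  have hu' : u = !₂[u 0, u 1] := by ext i; fin_cases i <;> rfl
  have h0 := h η hη hη0 (u 0) (hu 0) _ (hθ 0)
  have h1 := h η hη hη0 (u 1) (hu 1) _ (hθ 1)
  set a := Complex.exp ((2 * Real.pi * ω 0 * u 0 : ℝ) * Complex.I)
  set b := Complex.exp ((2 * Real.pi * ω 1 * u 1 : ℝ) * Complex.I)
  set a' := ∑ j ∈ Finset.range (K + 1), interpCoeff K η j (u 0) *
    Complex.exp ((2 * Real.pi * ω 0 * (j * η) : ℝ) * Complex.I)
  set b' := ∑ j ∈ Finset.range (K + 1), interpCoeff K η j (u 1) *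
    Complex.exp ((2 * Real.pi * ω 1 * (j * η) : ℝ) * Complex.I)
  have hab : planeWave u ω = a * b := by
    conv_lhs => rw [hu']
    exact hsplit _ _
  have hab' : ∑ p ∈ Finset.range (K + 1) ×ˢ Finset.range (K + 1),
          interpCoeff K η p.1 (u 0) * interpCoeff K η p.2 (u 1) *
            planeWave (clusterPoint η p) ω = a' * b' := by
    rw [Finset.sum_mul_sum, ← Finset.sum_product']
    refine Finset.sum_congr rfl fun p _ => ?_
    rw [clusterPoint, hsplit]
    ring
  rw [hab, hab']
  have hb1 : ‖b‖ = 1 := Complex.norm_exp_ofReal_mul_I _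
  have ha1 : ‖a‖ = 1 := Complex.norm_exp_ofReal_mul_I _
  have hsub : a * b - a' * b' = (a - a') * b + a * (b - b') - (a - a') * (b - b') := by ring
  have hm1 : min 1 (ε / 3) ≤ 1 := min_le_left _ _
  have hm2 : min 1 (ε / 3) ≤ ε / 3 := min_le_right _ _
  calc ‖a * b - a' * b'‖ ≤ ‖(a - a') * b‖ + ‖a * (b - b')‖ + ‖(a - a') * (b - b')‖ := by
        rw [hsub]
        exact (norm_sub_le _ _).trans (by gcongr; exact norm_add_le _ _)
    _ = ‖a - a'‖ + ‖b - b'‖ + ‖a - a'‖ * ‖b - b'‖ := by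
        rw [norm_mul, norm_mul, norm_mul, ha1, hb1]; ring
    _ ≤ ε := by nlinarith [norm_nonneg (a - a'), norm_nonneg (b - b')]

/-! ### Norm bounds from samples on clusters -/

lemma Bandlimited.exists_spectrum_cube {d : ℕ} {Ω : Set (Euc d)} (hΩ : IsCompact Ω) {W : ℝ}
    (hW : Ω ⊆ cube d W) {f : Euc d → ℂ} (hf : f ∈ Bandlimited Ω) :
    ∃ G : Euc d → ℂ, MemLp G 2 (volume.restrict (cube d W)) ∧
      eLpNorm G 2 (volume.restrict (cube d W)) = eLpNorm f 2 volume ∧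
      ∀ x, f x = ∫ ω in cube d W, G ω * planeWave x ω := by
  obtain ⟨F, hF, hF0, hFn, hfF⟩ := Bandlimited.exists_spectrum hΩ hf
  refine ⟨F, hF.restrict _, ?_, fun x => ?_⟩
  · rw [← hFn, ← eLpNorm_indicator_eq_eLpNorm_restrict (measurableSet_cube d W)]
    refine eLpNorm_congr_ae ?_
    filter_upwards [hF0] with ω hω
    by_cases h : ω ∈ cube d W
    · simp [h]
    · simp [h, hω fun h' => h (hW h')]
  · rw [hfF]
    refine (setIntegral_eq_of_subset_of_ae_sdiff_eq_zero
      (measurableSet_cube d W).nullMeasurableSet hW ?_).symm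
    filter_upwards [hF0] with ω hω h
    simp [hω h.2]

/-- Bessel's inequality with a bounded multiplier. -/
lemma tsum_integral_mul_planeWave_le {d : ℕ} {L W : ℕ} (hL : 0 < L) (hW : 0 < W) {G : Euc d → ℂ}
    (hG : MemLp G 2 (volume.restrict (cube d W))) {h : Euc d → ℂ} (hc : Continuous h) {b : ℝ}
    (hb : ∀ ω ∈ cube d W, ‖h ω‖ ≤ b) :
    ∑' n : Fin d → ℤ, ‖∫ ω in cube d W, G ω * h ω * planeWave (latticePoint L n) ω‖ₑ ^ 2 ≤
      ENNReal.ofReal ((2 * W) ^ d) *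
        (ENNReal.ofReal b * eLpNorm G 2 (volume.restrict (cube d W))) ^ 2 := by
  have hae : ∀ᵐ ω ∂(volume.restrict (cube d W)), ‖G ω * h ω‖ ≤ b * ‖G ω‖ := by
    filter_upwards [ae_restrict_mem (measurableSet_cube d W)] with ω hω
    rw [norm_mul, mul_comm]
    gcongr
    exact hb ω hω
  have hGh : MemLp (fun ω => G ω * h ω) 2 (volume.restrict (cube d W)) :=
    MemLp.of_le_mul hG (hG.1.mul hc.aestronglyMeasurable) hae
  refine (tsum_integral_planeWave_le hL hW hGh).trans ?_
  gcongr
  exact eLpNorm_le_mul_eLpNorm_of_ae_le_mul hae 2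

/-- The cubes have side `2L` at spacing `L` and overlap; only a covering is needed, since
periodization is used as an upper bound. -/
lemma exists_latticePoint_sub_mem_cube {d : ℕ} {L : ℕ} (hL : 0 < L) (x : Euc d) :
    ∃ n : Fin d → ℤ, x - latticePoint L n ∈ cube d L := by
  have hL' : (0 : ℝ) < L := by exact_mod_cast hL
  refine ⟨fun i => ⌊x i / L⌋, fun i => ?_⟩
  have h1 := Int.floor_le (x i / L)
  have h2 := Int.lt_floor_add_one (x i / L)
  rw [le_div_iff₀ hL'] at h1
  rw [div_lt_iff₀ hL'] at h2
  simp only [PiLp.sub_apply, latticePoint_apply, Set.mem_Icc]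
  constructor <;> nlinarith

/-- Periodization of an integral over a covering by cubes. -/
lemma lintegral_le_lintegral_tsum_latticePoint {d : ℕ} {L : ℕ} (hL : 0 < L) {g : Euc d → ℝ≥0∞}
    (hg : Measurable g) :
    ∫⁻ x, g x ≤ ∫⁻ u in cube d L, ∑' n : Fin d → ℤ, g (latticePoint L n + u) := by
  have hm : ∀ n : Fin d → ℤ, AEMeasurable (fun u => g (latticePoint L n + u))
      (volume.restrict (cube d L)) := fun n => (hg.comp (measurable_const_add _)).aemeasurable
  rw [lintegral_tsum hm]
  have hcov : (⋃ n : Fin d → ℤ, (fun x => -latticePoint L n + x) ⁻¹' cube d L) = Set.univ := by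
    refine Set.eq_univ_of_forall fun x => ?_
    obtain ⟨n, hn⟩ := exists_latticePoint_sub_mem_cube hL x
    refine Set.mem_iUnion.2 ⟨n, ?_⟩
    rw [Set.mem_preimage, neg_add_eq_sub]
    exact hn
  calc ∫⁻ x, g x = ∫⁻ x in ⋃ n : Fin d → ℤ, (fun x => -latticePoint L n + x) ⁻¹' cube d L, g x := by
        rw [hcov, Measure.restrict_univ]
    _ ≤ ∑' n : Fin d → ℤ, ∫⁻ x in (fun x => -latticePoint L n + x) ⁻¹' cube d L, g x :=
        lintegral_iUnion_le _ _
    _ = _ := by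
        refine tsum_congr fun n => ?_
        have h := (measurePreserving_add_left (volume : Measure (Euc d))
          (-latticePoint L n)).setLIntegral_comp_preimage (measurableSet_cube d L)
          (hg.comp (measurable_const_add (latticePoint L n)))
        simpa using h

lemma enorm_sum_mul_sq_le {ι : Type*} (s : Finset ι) (c a : ι → ℂ) {B : ℝ}
    (hc : ∀ i ∈ s, ‖c i‖ ≤ B) :
    ‖∑ i ∈ s, c i * a i‖ₑ ^ 2 ≤ ENNReal.ofReal (s.card * B ^ 2) * ∑ i ∈ s, ‖a i‖ₑ ^ 2 := by
  have h1 : ‖∑ i ∈ s, c i * a i‖ ^ 2 ≤ (s.card * B ^ 2) * ∑ i ∈ s, ‖a i‖ ^ 2 := by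
    calc ‖∑ i ∈ s, c i * a i‖ ^ 2 ≤ (∑ i ∈ s, ‖c i * a i‖) ^ 2 := by gcongr; exact norm_sum_le _ _
      _ ≤ s.card * ∑ i ∈ s, ‖c i * a i‖ ^ 2 := sq_sum_le_card_mul_sum_sq
      _ ≤ s.card * ∑ i ∈ s, B ^ 2 * ‖a i‖ ^ 2 := by
          gcongr with i hi
          rw [norm_mul, mul_pow]
          gcongr
          exact hc i hi
      _ = _ := by rw [← Finset.mul_sum, mul_assoc]
  have h2 := ENNReal.ofReal_le_ofReal h1
  rw [ENNReal.ofReal_mul (by positivity), ENNReal.ofReal_sum_of_nonneg (fun _ _ => by positivity),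
    ENNReal.ofReal_pow (norm_nonneg _), ofReal_norm] at h2
  simpa only [ENNReal.ofReal_pow (norm_nonneg _), ofReal_norm] using h2

lemma enorm_add_sq_le (a b : ℂ) : ‖a + b‖ₑ ^ 2 ≤ 2 * ‖a‖ₑ ^ 2 + 2 * ‖b‖ₑ ^ 2 := by
  have h1 : ‖a + b‖ ^ 2 ≤ 2 * ‖a‖ ^ 2 + 2 * ‖b‖ ^ 2 := by
    have := norm_add_le a b
    nlinarith [norm_nonneg (a + b), norm_nonneg a, norm_nonneg b, sq_nonneg (‖a‖ - ‖b‖)]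
  have h2 := ENNReal.ofReal_le_ofReal h1
  rw [ENNReal.ofReal_add (by positivity) (by positivity), ENNReal.ofReal_mul (by norm_num),
    ENNReal.ofReal_mul (by norm_num)] at h2
  simpa only [ENNReal.ofReal_pow (norm_nonneg _), ofReal_norm, ENNReal.ofReal_ofNat] using h2

lemma eLpNorm_two_sq {d : ℕ} (f : Euc d → ℂ) :
    eLpNorm f 2 volume ^ 2 = ∫⁻ x, ‖f x‖ₑ ^ 2 := by
  have := eLpNorm_nnreal_pow_eq_lintegral (μ := (volume : Measure (Euc d))) (f := f) (p := 2)
    (by norm_num)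
  simpa using this

/-- The indices of the nodes in a cluster. -/
def nodes (K : ℕ) : Finset (ℕ × ℕ) := Finset.range (K + 1) ×ˢ Finset.range (K + 1)

/-- The union of the translates by `L ℤ²` of a square cluster of mesh `1 / q`. -/
def sampleSet (L q K : ℕ) : Set (Euc 2) :=
  {x | ∃ n : Fin 2 → ℤ, ∃ p ∈ nodes K, x = latticePoint L n + clusterPoint (1 / q) p}

lemma exists_interpCoeff_bound (K : ℕ) (η T : ℝ) :
    ∃ B : ℝ, ∀ j ≤ K, ∀ t : ℝ, |t| ≤ T → ‖interpCoeff K η j t‖ ≤ B := by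
  have h : ∀ j, ∃ B, 0 ≤ B ∧ ∀ t ∈ Set.Icc (-T) T, ‖interpCoeff K η j t‖ ≤ B := fun j => by
    obtain ⟨B, hB⟩ := (isCompact_Icc (a := -T) (b := T)).exists_bound_of_continuousOn
      (continuous_interpCoeff K η j).continuousOn
    exact ⟨max B 0, le_max_right _ _, fun t ht => (hB t ht).trans (le_max_left _ _)⟩
  choose B hB0 hB using h
  refine ⟨∑ j ∈ Finset.range (K + 1), B j, fun j hj t ht => (hB j t (abs_le.1 ht)).trans ?_⟩
  exact Finset.single_le_sum (fun i _ => hB0 i) (Finset.mem_range.2 (by omega))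

section Sampling

variable {Ω : Set (Euc 2)} {L W : ℕ}

/-- Translation by `p` multiplies the spectrum by a unimodular plane wave, so Bessel's inequality
holds with the same constant for every shift. -/
lemma Bandlimited.tsum_shifted_lattice_le (hΩ : IsCompact Ω) (hL : 0 < L) (hW : 0 < W)
    (hΩW : Ω ⊆ cube 2 W) {f : Euc 2 → ℂ} (hf : f ∈ Bandlimited Ω) (p : Euc 2) :
    ∑' n : Fin 2 → ℤ, ‖f (latticePoint L n + p)‖ₑ ^ 2 ≤
      ENNReal.ofReal ((2 * W) ^ 2) * eLpNorm f 2 volume ^ 2 := by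
  obtain ⟨G, hG, hGn, hfG⟩ := Bandlimited.exists_spectrum_cube hΩ hΩW hf
  have h := tsum_integral_mul_planeWave_le hL hW hG (continuous_planeWave_right p) (b := 1)
    (fun ω _ => (norm_planeWave p ω).le)
  simp only [ENNReal.ofReal_one, one_mul, hGn] at h
  convert! h using 5 with n
  rw [hfG]
  simp_rw [add_comm _ p, planeWave_add, mul_assoc]

/-- Samples on small clusters control the norm: if the approximation error of the plane waves is
small, then the norm of a bandlimited function is bounded by its samples. -/
lemma Bandlimited.eLpNorm_sq_le_of_approx (hΩ : IsCompact Ω) (hL : 0 < L) (hW : 0 < W)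
    (hΩW : Ω ⊆ cube 2 W) {K : ℕ} {η b B : ℝ} (hb0 : 0 ≤ b)
    (hb : 2 * (2 * L) ^ 2 * ((2 * W) ^ 2 * b ^ 2) ≤ 1 / 2)
    (happ : ∀ u ∈ cube 2 L, ∀ ω ∈ cube 2 W,
        ‖planeWave u ω - ∑ p ∈ nodes K,
          interpCoeff K η p.1 (u 0) * interpCoeff K η p.2 (u 1) *
            planeWave (clusterPoint η p) ω‖ ≤ b)
    (hB : ∀ j ≤ K, ∀ t : ℝ, |t| ≤ L → ‖interpCoeff K η j t‖ ≤ B)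
    {f : Euc 2 → ℂ} (hf : f ∈ Bandlimited Ω) :
    eLpNorm f 2 volume ^ 2 ≤ ENNReal.ofReal (4 * (2 * L) ^ 2 * ((nodes K).card * B ^ 4)) *
      ∑' n : Fin 2 → ℤ, ∑ p ∈ nodes K, ‖f (latticePoint L n + clusterPoint η p)‖ₑ ^ 2 := by
  obtain ⟨G, hG, hGn, hfG⟩ := Bandlimited.exists_spectrum_cube hΩ hΩW hf
  set S := ∑' n : Fin 2 → ℤ, ∑ p ∈ nodes K, ‖f (latticePoint L n + clusterPoint η p)‖ₑ ^ 2 with hS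
  set N := eLpNorm f 2 volume with hN
  have hNtop : N ≠ ⊤ := hf.2.1.2.ne
  have hmeas : IsFiniteMeasure (volume.restrict (cube 2 (W : ℝ))) :=
    isFiniteMeasure_restrict.2 (by rw [volume_cube _ (Nat.cast_nonneg W)]; exact ENNReal.ofReal_ne_top)
  have hGint : Integrable G (volume.restrict (cube 2 (W : ℝ))) := hG.integrable (by norm_num)
  have hbdd : ∀ {h : Euc 2 → ℂ} (_ : Continuous h) {c : ℝ} (_ : ∀ ω ∈ cube 2 (W : ℝ), ‖h ω‖ ≤ c),
      Integrable (fun ω => G ω * h ω) (volume.restrict (cube 2 (W : ℝ))) := by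
    intro h hc c hcb
    refine hGint.mul_bdd (c := c) hc.aestronglyMeasurable ?_
    filter_upwards [ae_restrict_mem (measurableSet_cube 2 (W : ℝ))] with ω hω using hcb ω hω
  -- For a fixed offset `u`, the values on the shifted lattice are bounded by the cluster samples
  -- plus a small multiple of `‖f‖²`, uniformly in `u`.
  have key : ∀ u ∈ cube 2 (L : ℝ), ∑' n : Fin 2 → ℤ, ‖f (latticePoint L n + u)‖ₑ ^ 2 ≤
      2 * (ENNReal.ofReal ((nodes K).card * B ^ 4) * S) +
      2 * (ENNReal.ofReal ((2 * W) ^ 2) * (ENNReal.ofReal b * N) ^ 2) := by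
    intro u hu
    set c : ℕ × ℕ → ℂ := fun p => interpCoeff K η p.1 (u 0) * interpCoeff K η p.2 (u 1) with hc
    set e : Euc 2 → ℂ := fun ω => planeWave u ω - ∑ p ∈ nodes K, c p *
      planeWave (clusterPoint η p) ω with he
    have hec : Continuous e := by
      refine (continuous_planeWave_right u).sub (continuous_finsetSum _ fun p _ => ?_)
      exact continuous_const.mul (continuous_planeWave_right _)
    have heb : ∀ ω ∈ cube 2 (W : ℝ), ‖e ω‖ ≤ b := fun ω hω => happ u hu ω hω
    have hcB : ∀ p ∈ nodes K, ‖c p‖ ≤ B ^ 2 := by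
      intro p hp
      obtain ⟨h1, h2⟩ := Finset.mem_product.1 hp
      have h3 := hB p.1 (by have := Finset.mem_range.1 h1; omega) (u 0) (abs_le.2 (hu 0))
      have h4 := hB p.2 (by have := Finset.mem_range.1 h2; omega) (u 1) (abs_le.2 (hu 1))
      rw [hc, norm_mul, sq]
      have := (norm_nonneg _).trans h3
      gcongr
    -- The coefficients `c p` depend on `u` but not on `n`. The error multiplier `e` is likewise
    -- independent of `n`, so the remainders are Fourier coefficients of the single function `G *
    -- e`.
    have hsplit : ∀ n : Fin 2 → ℤ, f (latticePoint L n + u) =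
        ∑ p ∈ nodes K, c p * f (latticePoint L n + clusterPoint η p) +
          ∫ ω in cube 2 (W : ℝ), G ω * e ω * planeWave (latticePoint L n) ω := by
      intro n
      have h1 : ∀ ω, G ω * planeWave (latticePoint L n + u) ω =
          ∑ p ∈ nodes K, c p * (G ω * planeWave (latticePoint L n + clusterPoint η p) ω) +
            G ω * (e ω * planeWave (latticePoint L n) ω) := by
        intro ω
        simp only [planeWave_add, he]
        rw [sub_mul, mul_sub, Finset.sum_mul, Finset.mul_sum]
        have : ∑ p ∈ nodes K, c p * (G ω * (planeWave (latticePoint L n) ω *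
            planeWave (clusterPoint η p) ω)) = ∑ p ∈ nodes K, G ω * (c p *
            planeWave (clusterPoint η p) ω * planeWave (latticePoint L n) ω) :=
          Finset.sum_congr rfl fun p _ => by ring
        rw [this]; ring
      rw [hfG]
      simp_rw [h1]
      rw [integral_add, integral_finsetSum]
      · simp_rw [integral_const_mul, ← hfG, mul_assoc]
      · intro p _
        exact (hbdd (continuous_planeWave_right _) (c := 1)
          fun ω _ => (norm_planeWave _ ω).le).const_mul _
      · refine integrable_finsetSum _ fun p _ => ?_
        exact (hbdd (continuous_planeWave_right _) (c := 1)
          fun ω _ => (norm_planeWave _ ω).le).const_mul _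
      · refine hbdd (hec.mul (continuous_planeWave_right _)) (c := b) fun ω hω => ?_
        rw [norm_mul, norm_planeWave, mul_one]
        exact heb ω hω
    calc ∑' n : Fin 2 → ℤ, ‖f (latticePoint L n + u)‖ₑ ^ 2
        ≤ ∑' n : Fin 2 → ℤ, (2 * (ENNReal.ofReal ((nodes K).card * B ^ 4) *
            ∑ p ∈ nodes K, ‖f (latticePoint L n + clusterPoint η p)‖ₑ ^ 2) +
            2 * ‖∫ ω in cube 2 (W : ℝ), G ω * e ω * planeWave (latticePoint L n) ω‖ₑ ^ 2) := by
          refine ENNReal.tsum_le_tsum fun n => ?_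
          rw [hsplit n]
          refine (enorm_add_sq_le _ _).trans ?_
          gcongr
          refine (enorm_sum_mul_sq_le (nodes K) c _ hcB).trans (le_of_eq ?_)
          ring_nf
      _ ≤ _ := by
          rw [ENNReal.tsum_add, ENNReal.tsum_mul_left, ENNReal.tsum_mul_left,
            ENNReal.tsum_mul_left, ← hGn]
          gcongr
          exact tsum_integral_mul_planeWave_le hL hW hG hec heb
  have hL0 : (0 : ℝ) ≤ L := Nat.cast_nonneg L
  have hmain : N ^ 2 ≤ ENNReal.ofReal (2 * (2 * L) ^ 2 * ((nodes K).card * B ^ 4)) * S +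
      ENNReal.ofReal (1 / 2) * N ^ 2 := by
    calc N ^ 2 = ∫⁻ x, ‖f x‖ₑ ^ 2 := eLpNorm_two_sq f
      _ ≤ ∫⁻ u in cube 2 L, ∑' n : Fin 2 → ℤ, ‖f (latticePoint L n + u)‖ₑ ^ 2 :=
        lintegral_le_lintegral_tsum_latticePoint hL (hf.1.measurable.enorm.pow_const 2)
      _ ≤ ∫⁻ _ in cube 2 (L : ℝ), (2 * (ENNReal.ofReal ((nodes K).card * B ^ 4) * S) +
          2 * (ENNReal.ofReal ((2 * W) ^ 2) * (ENNReal.ofReal b * N) ^ 2)) :=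
        setLIntegral_mono measurable_const key
      _ = ENNReal.ofReal (2 * (2 * L) ^ 2 * ((nodes K).card * B ^ 4)) * S +
          ENNReal.ofReal (2 * (2 * L) ^ 2 * ((2 * W) ^ 2 * b ^ 2)) * N ^ 2 := by
        rw [setLIntegral_const, volume_cube _ hL0, mul_pow (ENNReal.ofReal b) N, ← ENNReal.ofReal_pow hb0,
          ENNReal.ofReal_mul (p := 2 * (2 * (L : ℝ)) ^ 2) (by positivity),
          ENNReal.ofReal_mul (p := 2 * (2 * (L : ℝ)) ^ 2) (by positivity),
          ENNReal.ofReal_mul (p := (2 : ℝ)) (by positivity),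
          ENNReal.ofReal_mul (p := (2 * (W : ℝ)) ^ 2) (by positivity), ENNReal.ofReal_ofNat]
        ring
      _ ≤ _ := by gcongr
  -- Finiteness of `‖f‖` permits cancelling half of its square from both sides.
  have hN2 : N ^ 2 ≠ ⊤ := ENNReal.pow_ne_top hNtop
  have hhalf : N ^ 2 = ENNReal.ofReal (1 / 2) * N ^ 2 + ENNReal.ofReal (1 / 2) * N ^ 2 := by
    rw [← add_mul, ← ENNReal.ofReal_add (by norm_num) (by norm_num)]
    norm_num
  have h3 : ENNReal.ofReal (1 / 2) * N ^ 2 ≤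
      ENNReal.ofReal (2 * (2 * L) ^ 2 * ((nodes K).card * B ^ 4)) * S := by
    nth_rewrite 1 [hhalf] at hmain
    exact (ENNReal.add_le_add_iff_right (ENNReal.mul_ne_top ENNReal.ofReal_ne_top hN2)).1 hmain
  rw [hhalf, ← two_mul]
  calc 2 * (ENNReal.ofReal (1 / 2) * N ^ 2)
      ≤ 2 * (ENNReal.ofReal (2 * (2 * L) ^ 2 * ((nodes K).card * B ^ 4)) * S) := by gcongr
    _ = _ := by
      rw [← mul_assoc, ← ENNReal.ofReal_ofNat 2, ← ENNReal.ofReal_mul (by norm_num)]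
      ring_nf

end Sampling

/-! ### The sample set: separation and stability -/

lemma sampleSet_coord_eq {L q : ℕ} (hq : 0 < q) (n : Fin 2 → ℤ) (p : ℕ × ℕ) (i : Fin 2) :
    (latticePoint L n + clusterPoint (1 / q) p) i =
      (((L * q : ℕ) * n i + (![p.1, p.2] i : ℕ) : ℤ) : ℝ) / q := by
  have : (q : ℝ) ≠ 0 := by positivity
  fin_cases i <;> simp [clusterPoint] <;> field_simp

lemma eq_of_mul_add_eq {M : ℕ} {a b : ℤ} {j k : ℕ} (hj : j < M) (hk : k < M)
    (h : (M : ℤ) * a + j = M * b + k) : a = b ∧ j = k := by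
  have h1 : ((M : ℤ) * a + j) / M = a := by
    rw [Int.mul_add_ediv_left _ _ (by omega), Int.ediv_eq_zero_of_lt (by omega) (by omega)]; simp
  have h2 : ((M : ℤ) * b + k) / M = b := by
    rw [Int.mul_add_ediv_left _ _ (by omega), Int.ediv_eq_zero_of_lt (by omega) (by omega)]; simp
  have hab : a = b := by rw [← h1, h, h2]
  subst hab
  exact ⟨rfl, by omega⟩

/-- Scaled by `q`, each coordinate is an integer `L q nᵢ + j` with `j ≤ K < L q`, so quotient and
remainder recover the lattice index and the node. -/
lemma sampleSet_injOn {L q K : ℕ} (hq : 0 < q) (hK : K < L * q) {n n' : Fin 2 → ℤ} {p p' : ℕ × ℕ}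
    (hp : p ∈ nodes K) (hp' : p' ∈ nodes K)
    (h : latticePoint L n + clusterPoint (1 / q) p = latticePoint L n' + clusterPoint (1 / q) p') :
    n = n' ∧ p = p' := by
  have hq' : (q : ℝ) ≠ 0 := by positivity
  simp only [nodes, Finset.mem_product, Finset.mem_range] at hp hp'
  have hi : ∀ i, ((L * q : ℕ) : ℤ) * n i + (![p.1, p.2] i : ℕ) =
      (L * q : ℕ) * n' i + (![p'.1, p'.2] i : ℕ) := by
    intro i
    have h1 := congrArg (fun x : Euc 2 => x i) h
    simp only [sampleSet_coord_eq hq] at h1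
    rw [div_left_inj' hq'] at h1
    exact_mod_cast h1
  have h0 := eq_of_mul_add_eq (by simp; omega) (by simp; omega) (hi 0)
  have h1 := eq_of_mul_add_eq (by simp; omega) (by simp; omega) (hi 1)
  refine ⟨?_, Prod.ext h0.2 h1.2⟩
  ext i
  fin_cases i
  exacts [h0.1, h1.1]

lemma uniformlyDiscrete_sampleSet {L q K : ℕ} (hq : 0 < q) :
    UniformlyDiscrete (sampleSet L q K) := by
  have hq' : (0 : ℝ) < q := by exact_mod_cast hq
  -- Points of `(1 / q) ℤ²` are at distance at least `1 / q`; half of that gives the strict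
  -- inequality.
  refine ⟨1 / (2 * q), by positivity, ?_⟩
  rintro x ⟨n, p, -, rfl⟩ y ⟨n', p', -, rfl⟩ hne
  set x := latticePoint (L : ℝ) n + clusterPoint (1 / q) p with hx
  set y := latticePoint (L : ℝ) n' + clusterPoint (1 / q) p' with hy
  obtain ⟨i, hi⟩ : ∃ i, x i ≠ y i := by
    by_contra! h
    exact hne (by ext i; exact h i)
  have h1 : 1 / (q : ℝ) ≤ |x i - y i| := by
    rw [hx, hy, sampleSet_coord_eq hq, sampleSet_coord_eq hq] at hi ⊢
    rw [← sub_div, abs_div, abs_of_pos hq', div_le_div_iff_of_pos_right hq', ← Int.cast_sub,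
      ← Int.cast_abs]
    have : ∀ a b : ℤ, (a : ℝ) / q ≠ b / q → (1 : ℝ) ≤ (|a - b| : ℤ) := by
      intro a b hab
      have : a ≠ b := fun h => hab (by rw [h])
      exact_mod_cast Int.one_le_abs (sub_ne_zero.2 this)
    exact this _ _ hi
  have h2 : |x i - y i| ≤ dist x y := by
    rw [dist_eq_norm, ← Real.norm_eq_abs]
    exact PiLp.norm_apply_le (x - y) i
  have h3 : 1 / (2 * q : ℝ) < 1 / q := by
    rw [div_lt_div_iff₀ (by positivity) hq']; linarith
  linarith

lemma tsum_sampleSet {L q K : ℕ} (hq : 0 < q) (hK : K < L * q) (g : Euc 2 → ℝ≥0∞) :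
    ∑' x : sampleSet L q K, g x =
      ∑' n : Fin 2 → ℤ, ∑ p ∈ nodes K, g (latticePoint L n + clusterPoint (1 / q) p) := by
  let φ : (Fin 2 → ℤ) × nodes K → sampleSet L q K := fun a =>
    ⟨latticePoint L a.1 + clusterPoint (1 / q) a.2, a.1, a.2, a.2.2, rfl⟩
  have hφ : Function.Bijective φ := by
    constructor
    · intro a b hab
      obtain ⟨h1, h2⟩ := sampleSet_injOn hq hK a.2.2 b.2.2 (congrArg Subtype.val hab)
      exact Prod.ext h1 (Subtype.ext h2)
    · rintro ⟨x, n, p, hp, rfl⟩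
      exact ⟨(n, ⟨p, hp⟩), rfl⟩
  rw [← (Equiv.ofBijective φ hφ).tsum_eq]
  refine (ENNReal.tsum_prod (f := fun n (p : nodes K) =>
    g (latticePoint L n + clusterPoint (1 / q) p))).trans (tsum_congr fun n => ?_)
  rw [tsum_fintype, ← Finset.sum_coe_sort (nodes K)]

/-- Periodic configurations of sufficiently small clusters with sufficiently many nodes are sets of
stable sampling. The number of nodes per cluster does not depend on the size of the clusters. -/
theorem exists_isStableSampling_sampleSet {Ω : Set (Euc 2)} (hΩ : IsCompact Ω) {L : ℕ}
    (hL : 0 < L) :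
    ∃ K q₀ : ℕ, ∀ q ≥ q₀, IsStableSampling Ω (sampleSet L q K) := by
  obtain ⟨r, hr⟩ := hΩ.isBounded.exists_norm_le
  obtain ⟨W, hWr⟩ := exists_nat_gt (max r 0)
  have hW : 0 < W := by
    have := (le_max_right _ _).trans_lt hWr
    exact_mod_cast this
  have hΩW : Ω ⊆ cube 2 W := by
    intro x hx i
    rw [Set.mem_Icc, ← abs_le, ← Real.norm_eq_abs]
    exact (PiLp.norm_apply_le x i).trans ((hr x hx).trans ((le_max_left _ _).trans hWr.le))
  have hL' : (0 : ℝ) < L := by exact_mod_cast hL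
  have hW' : (0 : ℝ) < W := by exact_mod_cast hW
  -- Chosen so that the error term is exactly `‖f‖² / 2`.
  set b : ℝ := 1 / (2 * (2 * L) * (2 * W)) with hbdef
  have hb0 : 0 < b := by positivity
  have hb : 2 * (2 * L) ^ 2 * ((2 * W) ^ 2 * b ^ 2) ≤ 1 / 2 := by
    rw [hbdef]; field_simp; norm_num
  obtain ⟨K, η₀, hη₀, h⟩ := exists_planeWave_approx L W b hL'.le hW'.le hb0
  obtain ⟨q₀, hq₀⟩ := exists_nat_gt (1 / η₀)
  -- `q ≥ K + 1` ensures `K < L q`, so that different clusters share no node.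
  refine ⟨K, max q₀ (K + 1), fun q hq => ?_⟩
  have hq1 : q₀ ≤ q := (le_max_left _ _).trans hq
  have hq2 : K + 1 ≤ q := (le_max_right _ _).trans hq
  have hq0 : 0 < q := by omega
  have hKL : K < L * q := by nlinarith
  have hq' : (0 : ℝ) < q := by exact_mod_cast hq0
  have hη : 1 / (q : ℝ) ≤ η₀ := by
    rw [div_le_iff₀ hq']
    rw [div_lt_iff₀ hη₀] at hq₀
    have : (q₀ : ℝ) ≤ q := by exact_mod_cast hq1
    nlinarith
  obtain ⟨B, hB⟩ := exists_interpCoeff_bound K (1 / q) L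
  set D : ℝ := 4 * (2 * L) ^ 2 * ((nodes K).card * B ^ 4) + 1 with hD
  have hD0 : 0 < D := by positivity
  have hcard : (0 : ℝ) ≤ (nodes K).card := Nat.cast_nonneg _
  refine ⟨D⁻¹, ((nodes K).card + 1) * (2 * W) ^ 2, by positivity, by positivity, fun f hf => ⟨?_, ?_⟩⟩
  · rw [tsum_sampleSet hq0 hKL fun x => ‖f x‖ₑ ^ 2]
    have h1 := Bandlimited.eLpNorm_sq_le_of_approx hΩ hL hW hΩW hb0.le hb
      (fun u hu ω hω => h (1 / q) (by positivity) hη u (fun i => abs_le.2 (hu i)) ω hω) hB hf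
    rw [ENNReal.ofReal_inv_of_pos hD0, ENNReal.inv_mul_le_iff (by simpa using hD0) (by simp)]
    refine h1.trans ?_
    gcongr
    simp [hD]
  · rw [tsum_sampleSet hq0 hKL fun x => ‖f x‖ₑ ^ 2, Summable.tsum_finsetSum fun _ _ => ENNReal.summable]
    calc ∑ p ∈ nodes K, ∑' n : Fin 2 → ℤ, ‖f (latticePoint L n + clusterPoint (1 / q) p)‖ₑ ^ 2
        ≤ ∑ p ∈ nodes K, ENNReal.ofReal ((2 * W) ^ 2) * eLpNorm f 2 volume ^ 2 :=
          Finset.sum_le_sum fun p _ => Bandlimited.tsum_shifted_lattice_le hΩ hL hW hΩW hf _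
      _ = ENNReal.ofReal ((nodes K).card * (2 * W) ^ 2) * eLpNorm f 2 volume ^ 2 := by
          rw [Finset.sum_const, nsmul_eq_mul, ENNReal.ofReal_mul hcard, ENNReal.ofReal_natCast,
            mul_assoc]
      _ ≤ _ := by
          gcongr
          linarith

/-! ### Arc length of Lipschitz curves -/

lemma _root_.LipschitzWith.eVariationOn_Icc_le {E : Type*} [PseudoEMetricSpace E] {γ : ℝ → E}
    {V : ℝ≥0} (hγ : LipschitzWith V γ) (p q : ℝ) :
    eVariationOn γ (Set.Icc p q) ≤ V * ENNReal.ofReal (q - p) := by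
  have h := hγ.lipschitzOnWith (s := Set.univ) |>.comp_eVariationOn_le (g := id)
    (s := Set.Icc p q) (Set.mapsTo_univ _ _)
  rwa [eVariationOn_id_Icc, Function.comp_id] at h

lemma eVariationOn_Icc_add_Icc {E : Type*} [PseudoEMetricSpace E] (γ : ℝ → E) {a b c : ℝ}
    (hab : a ≤ b) (hbc : b ≤ c) :
    eVariationOn γ (Set.Icc a b) + eVariationOn γ (Set.Icc b c) = eVariationOn γ (Set.Icc a c) := by
  simpa using eVariationOn.Icc_add_Icc γ (s := Set.univ) hab hbc (Set.mem_univ b)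

section ArcLength

variable {d : ℕ} {γ : ℝ → Euc d} {V : ℝ≥0}

lemma arcLengthParam_sub (hγ : LipschitzWith V γ) {p q : ℝ} (hpq : p ≤ q) :
    arcLengthParam γ q - arcLengthParam γ p = (eVariationOn γ (Set.Icc p q)).toReal := by
  rw [arcLengthParam, arcLengthParam, variationOnFromTo.sub_right
    (hγ.locallyBoundedVariationOn _) (Set.mem_univ _) (Set.mem_univ _) (Set.mem_univ _),
    variationOnFromTo.eq_of_le _ _ hpq, Set.univ_inter]

lemma eVariationOn_Icc_ne_top (hγ : LipschitzWith V γ) (p q : ℝ) :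
    eVariationOn γ (Set.Icc p q) ≠ ⊤ :=
  ((hγ.eVariationOn_Icc_le p q).trans_lt
    (ENNReal.mul_lt_top ENNReal.coe_lt_top ENNReal.ofReal_lt_top)).ne

lemma monotone_arcLengthParam (hγ : LipschitzWith V γ) : Monotone (arcLengthParam γ) := by
  intro p q hpq
  have := arcLengthParam_sub hγ hpq
  have h := ENNReal.toReal_nonneg (a := eVariationOn γ (Set.Icc p q))
  linarith

lemma continuous_arcLengthParam (hγ : LipschitzWith V γ) : Continuous (arcLengthParam γ) := by
  refine (LipschitzWith.of_le_add_mul V fun p q => ?_).continuous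
  rcases le_total p q with h | h
  · have h1 := monotone_arcLengthParam hγ h
    have : 0 ≤ V * dist p q := by positivity
    linarith
  · have h1 := arcLengthParam_sub hγ h
    have h2 := ENNReal.toReal_mono (by finiteness) (hγ.eVariationOn_Icc_le q p)
    rw [ENNReal.toReal_mul, ENNReal.toReal_ofReal (by linarith), ENNReal.coe_toReal] at h2
    rw [Real.dist_eq, abs_of_nonneg (by linarith)]
    linarith

lemma arcLengthIn_le_eVariationOn (hγ : LipschitzWith V γ) {S : Set (Euc d)} {p q : ℝ}
    (hpq : p ≤ q) (hS : γ ⁻¹' S ⊆ Set.Icc p q) :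
    arcLengthIn γ S ≤ eVariationOn γ (Set.Icc p q) := by
  have h1 : arcLengthParam γ '' (γ ⁻¹' S) ⊆ Set.Icc (arcLengthParam γ p) (arcLengthParam γ q) := by
    rintro _ ⟨t, ht, rfl⟩
    exact ⟨monotone_arcLengthParam hγ (hS ht).1, monotone_arcLengthParam hγ (hS ht).2⟩
  refine (measure_mono h1).trans ?_
  rw [Real.volume_Icc, arcLengthParam_sub hγ hpq, ENNReal.ofReal_toReal (eVariationOn_Icc_ne_top hγ p q)]

/-- The arc length parameter is continuous, so by the intermediate value theorem its image of `[p,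
q]` fills the whole interval between its end values. -/
lemma eVariationOn_le_arcLengthIn (hγ : LipschitzWith V γ) {S : Set (Euc d)} {p q : ℝ}
    (hpq : p ≤ q) (hS : Set.Icc p q ⊆ γ ⁻¹' S) :
    eVariationOn γ (Set.Icc p q) ≤ arcLengthIn γ S := by
  have h1 : Set.Icc (arcLengthParam γ p) (arcLengthParam γ q) ⊆ arcLengthParam γ '' (γ ⁻¹' S) :=
    (intermediate_value_Icc hpq (continuous_arcLengthParam hγ).continuousOn).trans
      (Set.image_mono hS)
  refine le_trans ?_ (measure_mono h1)
  rw [Real.volume_Icc, arcLengthParam_sub hγ hpq, ENNReal.ofReal_toReal (eVariationOn_Icc_ne_top hγ p q)]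

lemma arcLengthIn_eq_zero {S : Set (Euc d)} (hS : γ ⁻¹' S = ∅) : arcLengthIn γ S = 0 := by
  simp [arcLengthIn, hS]

end ArcLength

/-! ### Concatenating curves into tours -/

section Tour

variable {E : Type*}

/-- `Tour S p q ℓ`: some curve of length `ℓ` from `p` to `q` covers `S`. -/
def Tour [PseudoEMetricSpace E] (S : Set E) (p q : E) (ℓ : ℝ≥0∞) : Prop :=
  ∃ α : ℝ → E, ContinuousOn α (Set.Icc 0 1) ∧ α 0 = p ∧ α 1 = q ∧
    eVariationOn α (Set.Icc 0 1) = ℓ ∧ S ⊆ α '' Set.Icc 0 1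

lemma image_affine_Icc_zero_one {p q : ℝ} (hpq : p ≤ q) :
    (fun t : ℝ => p + t * (q - p)) '' Set.Icc 0 1 = Set.Icc p q := by
  ext x
  constructor
  · rintro ⟨t, ⟨h0, h1⟩, rfl⟩
    constructor <;> dsimp only <;> nlinarith
  · rintro ⟨h0, h1⟩
    rcases hpq.eq_or_lt with rfl | h
    · exact ⟨0, ⟨le_rfl, zero_le_one⟩, by simp; linarith⟩
    · refine ⟨(x - p) / (q - p), ⟨by apply div_nonneg <;> linarith, ?_⟩, ?_⟩
      · rw [div_le_one (by linarith)]; linarith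
      · have : q - p ≠ 0 := by linarith
        field_simp
        ring

lemma tour_of_Icc [PseudoEMetricSpace E] {γ : ℝ → E} {p q : ℝ} (hpq : p ≤ q)
    (hγ : ContinuousOn γ (Set.Icc p q)) :
    Tour (γ '' Set.Icc p q) (γ p) (γ q) (eVariationOn γ (Set.Icc p q)) := by
  have himg := image_affine_Icc_zero_one hpq
  refine ⟨γ ∘ fun t => p + t * (q - p), ?_, by simp, by simp, ?_, ?_⟩
  · refine hγ.comp (by fun_prop) ?_
    rw [← himg]
    exact Set.mapsTo_image _ _
  · rw [eVariationOn.comp_eq_of_monotoneOn, himg]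
    intro s _ t _ hst
    have := mul_le_mul_of_nonneg_right hst (sub_nonneg.2 hpq)
    dsimp only
    linarith
  · rw [Set.image_comp, himg]

lemma Tour.symm [PseudoEMetricSpace E] {S : Set E} {p q : E} {ℓ : ℝ≥0∞} (h : Tour S p q ℓ) :
    Tour S q p ℓ := by
  obtain ⟨α, hα, h0, h1, hv, hS⟩ := h
  have himg : (fun t : ℝ => 1 - t) '' Set.Icc 0 1 = Set.Icc 0 1 := by simp
  refine ⟨α ∘ fun t => 1 - t, ?_, by simp [h1], by simp [h0], ?_, ?_⟩
  · refine hα.comp (by fun_prop) ?_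
    intro t ht
    constructor <;> dsimp only <;> linarith [ht.1, ht.2]
  · rw [eVariationOn.comp_eq_of_antitoneOn, himg, hv]
    intro s _ t _ hst
    dsimp only
    linarith
  · rw [Set.image_comp, himg]
    exact hS

lemma Tour.trans [PseudoEMetricSpace E] {S T : Set E} {p q r : E} {ℓ ℓ' : ℝ≥0∞}
    (h : Tour S p q ℓ) (h' : Tour T q r ℓ') : Tour (S ∪ T) p r (ℓ + ℓ') := by
  obtain ⟨α, hα, h0, h1, hv, hS⟩ := h
  obtain ⟨β, hβ, h0', h1', hv', hT⟩ := h'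
  let γ : ℝ → E := fun t => if t ≤ 1 then α t else β (t - 1)
  have e1 : Set.EqOn γ α (Set.Icc 0 1) := fun t ht => by simp [γ, ht.2]
  have e2 : Set.EqOn γ (β ∘ fun t => t - 1) (Set.Icc 1 2) := fun t ht => by
    rcases ht.1.eq_or_lt with rfl | h
    · simp [γ, h1, h0']
    · simp [γ, h.not_ge]
  have himg : (fun t : ℝ => t - 1) '' Set.Icc 1 2 = Set.Icc 0 1 := by
    simp; norm_num
  have hu : Set.Icc (0 : ℝ) 1 ∪ Set.Icc 1 2 = Set.Icc 0 2 :=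
    Set.Icc_union_Icc_eq_Icc (by norm_num) (by norm_num)
  have hc1 : ContinuousOn γ (Set.Icc 0 1) := hα.congr e1
  have hc2 : ContinuousOn γ (Set.Icc 1 2) := by
    refine ContinuousOn.congr (hβ.comp (by fun_prop) ?_) e2
    rw [← himg]
    exact Set.mapsTo_image _ _
  have hc : ContinuousOn γ (Set.Icc 0 2) := by
    rw [← hu]
    exact hc1.union_of_isClosed hc2 isClosed_Icc isClosed_Icc
  have hv1 : eVariationOn γ (Set.Icc 0 1) = ℓ := by rw [eVariationOn.eq_of_eqOn e1, hv]
  have hv2 : eVariationOn γ (Set.Icc 1 2) = ℓ' := by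
    rw [eVariationOn.eq_of_eqOn e2, eVariationOn.comp_eq_of_monotoneOn, himg, hv']
    intro s _ t _ hst
    dsimp only
    linarith
  have ht := tour_of_Icc (by norm_num : (0 : ℝ) ≤ 2) hc
  rw [← eVariationOn_Icc_add_Icc γ zero_le_one one_le_two, hv1, hv2, ← hu, Set.image_union,
    e1.image_eq, e2.image_eq, Set.image_comp, himg] at ht
  have hp : γ 0 = p := by simp [γ, h0]
  have hr : γ 2 = r := by
    have : (2 : ℝ) - 1 = 1 := by norm_num
    simp [γ, this, h1']
  rw [hp, hr] at ht
  obtain ⟨δ, hδ, hδ0, hδ1, hδv, hδS⟩ := ht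
  exact ⟨δ, hδ, hδ0, hδ1, hδv, (Set.union_subset_union hS hT).trans hδS⟩

lemma Tour.mono [PseudoEMetricSpace E] {S T : Set E} {p q : E} {ℓ : ℝ≥0∞} (h : Tour T p q ℓ)
    (hST : S ⊆ T) : Tour S p q ℓ := by
  obtain ⟨α, hα, h0, h1, hv, hS⟩ := h
  exact ⟨α, hα, h0, h1, hv, hST.trans hS⟩

lemma tour_segment [NormedAddCommGroup E] [NormedSpace ℝ E] (p q : E) :
    Tour (∅ : Set E) p q (edist p q) := by
  refine ⟨AffineMap.lineMap p q, ?_, by simp, by simp, ?_, Set.empty_subset _⟩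
  · exact (AffineMap.lineMap_continuous).continuousOn
  · apply le_antisymm
    · have h : LipschitzWith (nndist p q) (AffineMap.lineMap p q : ℝ → E) :=
        lipschitzWith_lineMap p q
      refine (h.eVariationOn_Icc_le 0 1).trans ?_
      simp
    · have := eVariationOn.edist_le (AffineMap.lineMap p q : ℝ → E) (s := Set.Icc 0 1)
        (x := 0) (y := 1) (by simp) (by simp)
      simpa using this

/-- A tour can be lengthened by any finite amount. -/
lemma Tour.pad [NormedAddCommGroup E] [NormedSpace ℝ E] [Nontrivial E] {S : Set E} {p q : E}
    {ℓ ℓ' : ℝ≥0∞} (h : Tour S p q ℓ) (hle : ℓ ≤ ℓ') (hfin : ℓ' ≠ ⊤) : Tour S p q ℓ' := by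
  -- The surplus is spent on a straight detour from `q` to `q + v` and back, so `v` has half its
  -- length.
  obtain ⟨v, hv⟩ := exists_norm_eq E (c := ((ℓ' - ℓ).toReal / 2)) (by positivity)
  have h1 := (h.trans (tour_segment q (q + v))).trans (tour_segment (q + v) q)
  have h2 : edist q (q + v) = ENNReal.ofReal ((ℓ' - ℓ).toReal / 2) := by
    rw [edist_dist, dist_self_add_right, hv]
  rw [edist_comm (q + v) q, h2, add_assoc, ← ENNReal.ofReal_add (by positivity) (by positivity),
    add_halves, ENNReal.ofReal_toReal (by finiteness), add_tsub_cancel_of_le hle] at h1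
  simpa using h1

/-- Concatenation of finitely many curves, traversed in alternating directions. -/
lemma exists_tour_iUnion [NormedAddCommGroup E] [NormedSpace ℝ E] {S : ℕ → Set E} {A B : ℕ → E}
    {ℓ : ℕ → ℝ≥0∞} {D : ℝ≥0∞} (N : ℕ) (h : ∀ k ≤ N, Tour (S k) (A k) (B k) (ℓ k))
    (hA : ∀ k < N, edist (A k) (A (k + 1)) ≤ D) (hB : ∀ k < N, edist (B k) (B (k + 1)) ≤ D) :
    ∃ q ℓ', (q = A N ∨ q = B N) ∧ Tour (⋃ k ≤ N, S k) (A 0) q ℓ' ∧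
      ℓ' ≤ ∑ k ∈ Finset.range (N + 1), ℓ k + N * D := by
  induction N with
  | zero => exact ⟨B 0, ℓ 0, Or.inr rfl, by simpa using h 0 le_rfl, by simp⟩
  | succ N ih =>
    obtain ⟨q, ℓ', hq, ht, hl⟩ := ih (fun k hk => h k (by omega)) (fun k hk => hA k (by omega))
      (fun k hk => hB k (by omega))
    have hN := h (N + 1) le_rfl
    obtain ⟨q₁, q₂, hq₂, hd, hstep⟩ : ∃ q₁ q₂, (q₂ = A (N + 1) ∨ q₂ = B (N + 1)) ∧
        edist q q₁ ≤ D ∧ Tour (S (N + 1)) q₁ q₂ (ℓ (N + 1)) := by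
      rcases hq with rfl | rfl
      · exact ⟨_, _, Or.inr rfl, hA N (by omega), hN⟩
      · exact ⟨_, _, Or.inl rfl, hB N (by omega), hN.symm⟩
    refine ⟨q₂, _, hq₂, ((ht.trans (tour_segment q q₁)).trans hstep).mono ?_, ?_⟩
    · intro x hx
      simp only [Set.mem_iUnion] at hx
      obtain ⟨k, hk, hx⟩ := hx
      rcases Nat.le_succ_iff.1 hk with hk | rfl
      · exact Or.inl (Or.inl (Set.mem_iUnion₂.2 ⟨k, hk, hx⟩))
      · exact Or.inr hx
    · rw [Finset.sum_range_succ _ (N + 1)]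
      calc ℓ' + edist q q₁ + ℓ (N + 1) ≤
            (∑ k ∈ Finset.range (N + 1), ℓ k + N * D) + D + ℓ (N + 1) := by gcongr
        _ = _ := by push_cast; ring

end Tour

/-! ### Nearly horizontal curves: density and non-degeneracy -/

lemma sqrt_le_sqrt_add_sqrt {u v w : ℝ} (hw : 0 ≤ w) (h : u ≤ v + w) : √u ≤ √v + √w := by
  rcases le_total v 0 with hv | hv
  · rw [Real.sqrt_eq_zero_of_nonpos hv, zero_add]
    exact Real.sqrt_le_sqrt (by linarith)
  · rw [Real.sqrt_le_left (by positivity)]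
    nlinarith [Real.sq_sqrt hv, Real.sq_sqrt hw, Real.sqrt_nonneg v, Real.sqrt_nonneg w]

lemma dist_pair_sq (s u : ℝ) (x : Euc 2) :
    dist (!₂[s, u] : Euc 2) x ^ 2 = (s - x 0) ^ 2 + (u - x 1) ^ 2 := by
  rw [EuclideanSpace.dist_eq, Real.sq_sqrt (by positivity), Fin.sum_univ_two, Real.dist_eq,
    Real.dist_eq, sq_abs, sq_abs]
  simp

/-- A family of Lipschitz curves that stay near the horizontal lines at heights in `L ℤ`. -/
structure NearHorizontal (γ : ℤ → ℝ → Euc 2) (L C : ℝ) (V : ℝ≥0) : Prop where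
  pos : 0 < L
  nonneg : 0 ≤ C
  lipschitz : ∀ m, LipschitzWith V (γ m)
  near : ∀ m t, dist (γ m t) !₂[t, L * m] ≤ C

/-- Half the length of the chord at height `y` of a disc of radius `r`. -/
noncomputable def halfChord (r y : ℝ) : ℝ := √(r ^ 2 - y ^ 2)

namespace NearHorizontal

variable {γ : ℤ → ℝ → Euc 2} {L C : ℝ} {V : ℝ≥0}

/-- The trajectory set of a family of nearly horizontal curves. -/
noncomputable def trajectorySet (h : NearHorizontal γ L C V) : TrajectorySet 2 where
  ι := ℤ
  countable := inferInstance
  curve := γ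
  continuous m := (h.lipschitz m).continuous
  rectifiable m a b := eVariationOn_Icc_ne_top (h.lipschitz m) a b

lemma sq_add_sq_le (h : NearHorizontal γ L C V) {m : ℤ} {t a : ℝ} {x : Euc 2}
    (ht : γ m t ∈ Metric.closedBall x a) :
    (t - x 0) ^ 2 + (L * m - x 1) ^ 2 ≤ (a + C) ^ 2 := by
  rw [← dist_pair_sq]
  have := dist_triangle_left (!₂[t, L * m] : Euc 2) x (γ m t)
  have h1 := h.near m t
  have h2 : dist (γ m t) x ≤ a := ht
  exact pow_le_pow_left₀ dist_nonneg (by linarith) 2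

lemma mem_closedBall (h : NearHorizontal γ L C V) {m : ℤ} {t a : ℝ} {x : Euc 2} (ha : C ≤ a)
    (ht : (t - x 0) ^ 2 + (L * m - x 1) ^ 2 ≤ (a - C) ^ 2) :
    γ m t ∈ Metric.closedBall x a := by
  rw [← dist_pair_sq] at ht
  have h1 := (pow_le_pow_iff_left₀ dist_nonneg (sub_nonneg.2 ha) two_ne_zero).1 ht
  have := dist_triangle (γ m t) (!₂[t, L * m] : Euc 2) x
  have h2 := h.near m t
  rw [Metric.mem_closedBall]
  linarith

lemma preimage_subset (h : NearHorizontal γ L C V) (m : ℤ) (a : ℝ) (x : Euc 2) :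
    γ m ⁻¹' Metric.closedBall x a ⊆ Set.Icc (x 0 - halfChord (a + C) (L * m - x 1))
      (x 0 + halfChord (a + C) (L * m - x 1)) := by
  intro t ht
  have h1 := h.sq_add_sq_le ht
  have h2 : |t - x 0| ≤ halfChord (a + C) (L * m - x 1) := Real.abs_le_sqrt (by linarith)
  rw [abs_le] at h2
  constructor <;> linarith

lemma abs_height_le (h : NearHorizontal γ L C V) {m : ℤ} {t a : ℝ} {x : Euc 2} (ha : 0 ≤ a)
    (ht : γ m t ∈ Metric.closedBall x a) : |L * m - x 1| ≤ a + C := by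
  have h1 := h.sq_add_sq_le ht
  have := h.nonneg
  exact abs_le_of_sq_le_sq (by nlinarith [sq_nonneg (t - x 0)]) (by linarith)

/-- The part of a curve over a chord is not much longer than its part in the disc. -/
lemma eVariationOn_chord_le (h : NearHorizontal γ L C V) (m : ℤ) {a : ℝ} (x : Euc 2) (ha : C ≤ a) :
    eVariationOn (γ m) (Set.Icc (x 0 - halfChord (a + C) (L * m - x 1))
      (x 0 + halfChord (a + C) (L * m - x 1))) ≤
      arcLengthIn (γ m) (Metric.closedBall x a) + ENNReal.ofReal (V * (2 * √(4 * a * C))) := by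
  set y := L * m - x 1 with hy
  have hC := h.nonneg
  have ha0 : 0 ≤ a := hC.trans ha
  have ho : 0 ≤ halfChord (a + C) y := Real.sqrt_nonneg _
  have hi : 0 ≤ halfChord (a - C) y := Real.sqrt_nonneg _
  -- `(a + C)² - (a - C)² = 4aC`.
  have hoi : halfChord (a + C) y ≤ halfChord (a - C) y + √(4 * a * C) :=
    sqrt_le_sqrt_add_sqrt (by positivity) (by ring_nf; rfl)
  -- Over the chord of the disc of radius `a - C` the curve certainly stays in the ball; only two
  -- end pieces are extra. If that chord is empty, the outer half chord is itself at most `√(4aC)`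
  -- and counts wholly as error.
  by_cases hya : |y| ≤ a - C
  · have hy2 : y ^ 2 ≤ (a - C) ^ 2 := sq_le_sq' (by linarith [(abs_le.1 hya).1]) (abs_le.1 hya).2
    have hio : halfChord (a - C) y ≤ halfChord (a + C) y := Real.sqrt_le_sqrt (by nlinarith)
    have hin : Set.Icc (x 0 - halfChord (a - C) y) (x 0 + halfChord (a - C) y) ⊆
        γ m ⁻¹' Metric.closedBall x a := by
      intro t ht
      refine h.mem_closedBall ha ?_
      have h1 : (t - x 0) ^ 2 ≤ halfChord (a - C) y ^ 2 :=
        sq_le_sq' (by linarith [ht.1]) (by linarith [ht.2])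
      rw [halfChord, Real.sq_sqrt (by linarith)] at h1
      linarith
    rw [← eVariationOn_Icc_add_Icc (γ m) (b := x 0 + halfChord (a - C) y) (by linarith)
      (by linarith), ← eVariationOn_Icc_add_Icc (γ m) (b := x 0 - halfChord (a - C) y)
      (by linarith) (by linarith)]
    have h1 := (h.lipschitz m).eVariationOn_Icc_le (x 0 - halfChord (a + C) y)
      (x 0 - halfChord (a - C) y)
    have h2 := (h.lipschitz m).eVariationOn_Icc_le (x 0 + halfChord (a - C) y)
      (x 0 + halfChord (a + C) y)
    have h3 := eVariationOn_le_arcLengthIn (h.lipschitz m) (by linarith) hin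
    calc _ ≤ V * ENNReal.ofReal (x 0 - halfChord (a - C) y - (x 0 - halfChord (a + C) y)) +
          arcLengthIn (γ m) (Metric.closedBall x a) +
          V * ENNReal.ofReal (x 0 + halfChord (a + C) y - (x 0 + halfChord (a - C) y)) := by gcongr
      _ ≤ V * ENNReal.ofReal (√(4 * a * C)) + arcLengthIn (γ m) (Metric.closedBall x a) +
          V * ENNReal.ofReal (√(4 * a * C)) := by gcongr <;> linarith
      _ = _ := by
        rw [ENNReal.ofReal_mul (by positivity), ENNReal.ofReal_mul (by norm_num),
          ENNReal.ofReal_coe_nnreal, ENNReal.ofReal_ofNat]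
        ring
  · have h0 : halfChord (a - C) y = 0 := by
      refine Real.sqrt_eq_zero_of_nonpos ?_
      have := sq_le_sq' (a := a - C) (b := |y|) (by linarith [abs_nonneg y]) (by linarith)
      rw [sq_abs] at this
      linarith
    refine le_add_left (((h.lipschitz m).eVariationOn_Icc_le _ _).trans ?_)
    rw [ENNReal.ofReal_mul (by positivity), ENNReal.ofReal_coe_nnreal]
    gcongr
    linarith

/-- The heights at which curves meet a ball are among boundedly many consecutive ones. -/
lemma exists_height_range (h : NearHorizontal γ L C V) {a : ℝ} (ha : 0 ≤ a) (x : Euc 2) :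
    ∃ (m₀ : ℤ) (N : ℕ), (N : ℝ) + 1 ≤ 2 * (a + C) / L + 3 ∧
      (∀ m : ℤ, |L * m - x 1| ≤ a + C → ∃ k ≤ N, m = m₀ + (k : ℤ)) ∧
      ∀ k : ℕ, k ≤ N → |L * (m₀ + (k : ℤ) : ℤ) - x 1| ≤ a + C + 2 * L := by
  have hL := h.pos
  have hC := h.nonneg
  have hR : 0 ≤ 2 * (a + C) / L := by positivity
  set m₀ := ⌊(x 1 - (a + C)) / L⌋ with hm
  have h1 : L * m₀ ≤ x 1 - (a + C) := by
    have := Int.floor_le ((x 1 - (a + C)) / L)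
    rw [le_div_iff₀ hL] at this
    linarith
  have h2 : x 1 - (a + C) < L * m₀ + L := by
    have := Int.lt_floor_add_one ((x 1 - (a + C)) / L)
    rw [div_lt_iff₀ hL] at this
    linarith
  have h3 := Nat.ceil_lt_add_one hR
  have h4 := Nat.le_ceil (2 * (a + C) / L)
  set n := ⌈2 * (a + C) / L⌉₊
  have h5 : 2 * (a + C) ≤ n * L := by rwa [div_le_iff₀ hL] at h4
  have h6 : n * L ≤ 2 * (a + C) + L := by
    have := mul_lt_mul_of_pos_right h3 hL
    rw [add_mul, div_mul_cancel₀ _ hL.ne'] at this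
    linarith
  -- The extra row compensates for `m₀` lying up to one spacing below the required range.
  refine ⟨m₀, n + 1, by push_cast; linarith, fun m hmR => ?_, fun k hk => ?_⟩
  · rw [abs_le] at hmR
    have h7 : m₀ ≤ m := by
      have : L * m₀ ≤ L * m := by linarith
      exact_mod_cast le_of_mul_le_mul_left this hL
    have h8 : m ≤ m₀ + (n + 1 : ℕ) := by
      have : L * m ≤ L * (m₀ + (n + 1 : ℕ) : ℤ) := by push_cast; linarith
      exact_mod_cast le_of_mul_le_mul_left this hL
    exact ⟨(m - m₀).toNat, by omega, by omega⟩
  · have h7 : (k : ℝ) ≤ n + 1 := by exact_mod_cast hk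
    have h8 : L * k ≤ L * (n + 1) := by gcongr
    have h9 : 0 ≤ L * k := by positivity
    rw [abs_le]
    push_cast
    constructor <;> linarith

lemma lengthInBall_le (h : NearHorizontal γ L C V) {a : ℝ} (ha : 0 ≤ a) (x : Euc 2) :
    h.trajectorySet.lengthInBall a x ≤
      ENNReal.ofReal ((2 * (a + C) / L + 3) * (V * (2 * (a + C)))) := by
  obtain ⟨m₀, N, hN, hm, -⟩ := h.exists_height_range ha x
  have hC := h.nonneg
  set s : Finset ℤ := (Finset.range (N + 1)).image fun k : ℕ => m₀ + (k : ℤ)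
  have hs : ∀ m ∉ s, arcLengthIn (γ m) (Metric.closedBall x a) = 0 := by
    intro m hms
    refine arcLengthIn_eq_zero (Set.eq_empty_iff_forall_notMem.2 fun t ht => hms ?_)
    obtain ⟨k, hk, rfl⟩ := hm m (h.abs_height_le ha ht)
    exact Finset.mem_image.2 ⟨k, Finset.mem_range.2 (by omega), rfl⟩
  have hb : ∀ m, arcLengthIn (γ m) (Metric.closedBall x a) ≤
      ENNReal.ofReal (V * (2 * (a + C))) := by
    intro m
    have h0 : 0 ≤ halfChord (a + C) (L * m - x 1) := Real.sqrt_nonneg _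
    have h1 : halfChord (a + C) (L * m - x 1) ≤ a + C := by
      rw [halfChord, Real.sqrt_le_left (by positivity)]
      nlinarith [sq_nonneg (L * m - x 1)]
    refine (arcLengthIn_le_eVariationOn (h.lipschitz m) (by linarith)
      (h.preimage_subset m a x)).trans (((h.lipschitz m).eVariationOn_Icc_le _ _).trans ?_)
    rw [ENNReal.ofReal_mul (by positivity), ENNReal.ofReal_coe_nnreal]
    gcongr
    linarith
  calc h.trajectorySet.lengthInBall a x
      = ∑' m : ℤ, arcLengthIn (γ m) (Metric.closedBall x a) := rfl
    _ = ∑ m ∈ s, arcLengthIn (γ m) (Metric.closedBall x a) := tsum_eq_sum hs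
    _ ≤ ∑ m ∈ s, ENNReal.ofReal (V * (2 * (a + C))) := Finset.sum_le_sum fun m _ => hb m
    _ = s.card * ENNReal.ofReal (V * (2 * (a + C))) := by rw [Finset.sum_const, nsmul_eq_mul]
    _ ≤ ((N + 1 : ℕ) : ℝ≥0∞) * ENNReal.ofReal (V * (2 * (a + C))) := by
        gcongr
        exact Finset.card_image_le.trans (by simp)
    _ = ENNReal.ofReal (((N + 1 : ℕ) : ℝ) * (V * (2 * (a + C)))) := by
        rw [ENNReal.ofReal_mul (p := ((N + 1 : ℕ) : ℝ)) (by positivity), ENNReal.ofReal_natCast]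
    _ ≤ _ := by
        gcongr
        push_cast
        exact hN

lemma upperPathDensity_le (h : NearHorizontal γ L C V) :
    h.trajectorySet.upperPathDensity ≤ ENNReal.ofReal (28 * V / L) := by
  have hL := h.pos
  have hC := h.nonneg
  refine limsup_le_of_le (by isBoundedDefault) ?_
  filter_upwards [eventually_ge_atTop C, eventually_ge_atTop L] with a haC haL
  have ha : 0 < a := hL.trans_le haL
  refine iSup_le fun x => ?_
  rw [EuclideanSpace.volume_closedBall_fin_two, ← ENNReal.ofReal_pow ha.le,
    ← ENNReal.ofReal_mul (by positivity)]
  refine ENNReal.div_le_of_le_mul ((h.lengthInBall_le ha.le x).trans ?_)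
  rw [← ENNReal.ofReal_mul (by positivity)]
  refine ENNReal.ofReal_le_ofReal ?_
  -- Uses `C ≤ a` and `L ≤ a`. With chords of length at most `4a` this gives `28 = 7 * 4`, the
  -- factor `π ≥ 1` of the disc's area being discarded.
  have h1 : 2 * (a + C) / L + 3 ≤ 7 * a / L := by
    rw [div_add' _ _ _ hL.ne', div_le_div_iff_of_pos_right hL]
    linarith
  calc (2 * (a + C) / L + 3) * (V * (2 * (a + C))) ≤ (7 * a / L) * (V * (2 * (a + a))) := by
        gcongr
    _ = 28 * V / L * (a ^ 2 * 1) := by ring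
    _ ≤ _ := by
        gcongr
        linarith [Real.pi_gt_three]

lemma edist_curve_le (h : NearHorizontal γ L C V) {m m' : ℤ} {t t' e r : ℝ}
    (ht : |t - t'| ≤ e) (hm : |L * m - L * m'| ≤ r) :
    edist (γ m t) (γ m' t') ≤ ENNReal.ofReal (2 * C + r + e) := by
  have he : 0 ≤ e := (abs_nonneg _).trans ht
  have hr : 0 ≤ r := (abs_nonneg _).trans hm
  rw [edist_dist]
  refine ENNReal.ofReal_le_ofReal ?_
  have h1 : dist (!₂[t, L * m] : Euc 2) !₂[t', L * m'] ≤ e + r := by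
    refine (pow_le_pow_iff_left₀ dist_nonneg (by positivity) two_ne_zero).1 ?_
    rw [dist_pair_sq]
    have h1 : (t - t') ^ 2 ≤ e ^ 2 := by rw [← sq_abs]; gcongr
    have h2 : (L * m - L * m') ^ 2 ≤ r ^ 2 := by rw [← sq_abs]; gcongr
    simp only [Matrix.cons_val_zero, Matrix.cons_val_one]
    nlinarith
  have h2 := dist_triangle4 (γ m t) (!₂[t, L * m] : Euc 2) !₂[t', L * m'] (γ m' t')
  have h3 := h.near m t
  have h4 := h.near m' t'
  rw [dist_comm] at h4
  linarith

/-- Hölder continuity of the square root with exponent `1/2`. It also covers rows missing the disc,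
where `√` of a negative number is `0`. -/
lemma abs_halfChord_sub_le {r y y' w : ℝ} (hw : |y ^ 2 - y' ^ 2| ≤ w) :
    |halfChord r y - halfChord r y'| ≤ √w := by
  have hw0 : 0 ≤ w := (abs_nonneg _).trans hw
  rw [abs_le] at hw
  have h1 : halfChord r y ≤ halfChord r y' + √w :=
    sqrt_le_sqrt_add_sqrt hw0 (by linarith)
  have h2 : halfChord r y' ≤ halfChord r y + √w :=
    sqrt_le_sqrt_add_sqrt hw0 (by linarith)
  rw [abs_le]
  constructor <;> linarith

/-- The part of the curves in a disc is covered by a boustrophedon tour. -/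
lemma exists_tour (h : NearHorizontal γ L C V) {a : ℝ} (ha : C ≤ a) (x : Euc 2) :
    ∃ p q ℓ, Tour (h.trajectorySet.points ∩ Metric.closedBall x a) p q ℓ ∧
      ℓ ≤ h.trajectorySet.lengthInBall a x +
        ENNReal.ofReal ((2 * (a + C) / L + 3) *
          (V * (2 * √(4 * a * C)) + (2 * C + L + √(L * (2 * (a + C) + 5 * L))))) := by
  have hL := h.pos
  have hC := h.nonneg
  have ha0 : 0 ≤ a := hC.trans ha
  obtain ⟨m₀, N, hN, hm, hk⟩ := h.exists_height_range ha0 x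
  set R := a + C
  let m : ℕ → ℤ := fun k => m₀ + (k : ℤ)
  let c : ℕ → ℝ := fun k => halfChord R (L * m k - x 1)
  have hc0 : ∀ k, 0 ≤ c k := fun k => Real.sqrt_nonneg _
  set D : ℝ := 2 * C + L + √(L * (2 * R + 5 * L))
  set E : ℝ := V * (2 * √(4 * a * C))
  have hE : 0 ≤ E := by positivity
  have hD : 0 ≤ D := by positivity
  -- The squared heights of adjacent rows differ by at most `L (2R + 5L)`, so the chord ends shift
  -- by only `O(√R)`, even near the top and bottom of the disc.
  have hstep : ∀ k < N, |c k - c (k + 1)| ≤ √(L * (2 * R + 5 * L)) := by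
    intro k hkN
    refine abs_halfChord_sub_le ?_
    have h1 := abs_le.1 (hk k hkN.le)
    have h2 : L * (m (k + 1) : ℝ) = L * (m k : ℝ) + L := by simp only [m]; push_cast; ring
    have h3 : (L * m k - x 1) ^ 2 - (L * m (k + 1) - x 1) ^ 2 = -(L * (2 * (L * m k - x 1) + L)) := by
      rw [h2]; ring
    rw [h3, abs_neg, abs_mul, abs_of_pos hL]
    gcongr
    rw [abs_le]
    simp only [m]
    constructor <;> linarith
  have hheight : ∀ k, |L * (m k : ℝ) - L * m (k + 1)| ≤ L := by
    intro k
    have h2 : L * (m k : ℝ) - L * m (k + 1) = -L := by simp only [m]; push_cast; ring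
    rw [h2, abs_neg, abs_of_pos hL]
  obtain ⟨q, ℓ, -, ht, hl⟩ := exists_tour_iUnion (E := Euc 2)
    (S := fun k => γ (m k) '' Set.Icc (x 0 - c k) (x 0 + c k))
    (A := fun k => γ (m k) (x 0 - c k)) (B := fun k => γ (m k) (x 0 + c k))
    (ℓ := fun k => eVariationOn (γ (m k)) (Set.Icc (x 0 - c k) (x 0 + c k)))
    (D := ENNReal.ofReal D) N
    (fun k _ => tour_of_Icc (by linarith [hc0 k]) (h.lipschitz _).continuous.continuousOn)
    (fun k hkN => h.edist_curve_le (by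
      rw [← abs_neg]
      convert! hstep k hkN using 2
      ring) (hheight k))
    (fun k hkN => h.edist_curve_le (by
      convert! hstep k hkN using 2
      ring) (hheight k))
  refine ⟨_, q, ℓ, ht.mono ?_, hl.trans ?_⟩
  · rintro z ⟨hz, hza⟩
    obtain ⟨i, t, rfl⟩ := Set.mem_iUnion.1 hz
    change γ i t ∈ _ at hza
    obtain ⟨k, hkN, rfl⟩ := hm i (h.abs_height_le ha0 hza)
    exact Set.mem_iUnion₂.2 ⟨k, hkN, t, h.preimage_subset _ a x hza, rfl⟩
  · have h1 : ∑ k ∈ Finset.range (N + 1), arcLengthIn (γ (m k)) (Metric.closedBall x a) ≤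
        h.trajectorySet.lengthInBall a x := by
      refine (ENNReal.sum_le_tsum _).trans ?_
      exact ENNReal.tsum_comp_le_tsum_of_injective (f := m) (fun i j hij => by
        simpa [m] using hij) fun i => arcLengthIn (γ i) (Metric.closedBall x a)
    calc _ ≤ ∑ k ∈ Finset.range (N + 1), (arcLengthIn (γ (m k)) (Metric.closedBall x a) +
            ENNReal.ofReal E) + N * ENNReal.ofReal D := by
          gcongr with k hk
          exact h.eVariationOn_chord_le (m k) x ha
      _ ≤ h.trajectorySet.lengthInBall a x + ((N + 1 : ℕ) * ENNReal.ofReal E +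
            (N + 1 : ℕ) * ENNReal.ofReal D) := by
          rw [Finset.sum_add_distrib, Finset.sum_const, Finset.card_range, nsmul_eq_mul, add_assoc]
          gcongr
          omega
      _ = h.trajectorySet.lengthInBall a x + ENNReal.ofReal ((N + 1 : ℕ) * (E + D)) := by
          rw [ENNReal.ofReal_mul (p := ((N + 1 : ℕ) : ℝ)) (by positivity), ENNReal.ofReal_add hE hD,
            ENNReal.ofReal_natCast, mul_add]
      _ ≤ _ := by
          gcongr
          push_cast
          exact hN

lemma isLittleO_mul_sqrt (κ : ℝ) :
    (fun a : ℝ => κ * (a * √a)) =o[atTop] fun a : ℝ => a ^ 2 := by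
  have h : (fun a : ℝ => √a) =o[atTop] fun a : ℝ => a := by
    rw [isLittleO_iff]
    intro c hc
    filter_upwards [eventually_ge_atTop ((c⁻¹) ^ 2), eventually_ge_atTop 0] with a ha ha0
    have h1 : c⁻¹ ≤ √a := Real.le_sqrt_of_sq_le ha
    have h2 : 1 ≤ c * √a := by
      rw [inv_le_iff_one_le_mul₀ hc] at h1
      linarith
    rw [Real.norm_of_nonneg (Real.sqrt_nonneg a), Real.norm_of_nonneg ha0]
    nlinarith [Real.mul_self_sqrt ha0, Real.sqrt_nonneg a]
  simp_rw [sq]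
  exact ((isBigO_refl _ _).mul_isLittleO h).const_mul_left κ

lemma nonDegenerate (h : NearHorizontal γ L C V) : h.trajectorySet.NonDegenerate := by
  have hL := h.pos
  have hC := h.nonneg
  -- For `a ≥ max 1 C`, the number of rows is at most `(4 / L + 3) a` and the excess per row is at
  -- most the second factor times `√a`.
  set κ : ℝ := (4 / L + 3) * (4 * V * √C + (2 * C + L + √(L * (4 + 5 * L)))) with hκ
  have hκ0 : 0 ≤ κ := by positivity
  refine ⟨fun a => (κ * (a * √a)).toNNReal, ?_, max 1 C, fun a ha x => ?_⟩
  · refine (isLittleO_mul_sqrt κ).congr' ?_ EventuallyEq.rfl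
    filter_upwards [eventually_ge_atTop 0] with a ha
    rw [Real.coe_toNNReal _ (by positivity)]
  · have ha1 : 1 ≤ a := (le_max_left _ _).trans ha
    have haC : C ≤ a := (le_max_right _ _).trans ha
    have ha0 : 0 ≤ a := by linarith
    have hs1 : 1 ≤ √a := Real.one_le_sqrt.2 ha1
    obtain ⟨p, q, ℓ, ht, hl⟩ := h.exists_tour haC x
    have h1 : 2 * (a + C) / L + 3 ≤ (4 / L + 3) * a := by
      have : 2 * (a + C) / L ≤ 4 * a / L := div_le_div_of_nonneg_right (by linarith) hL.le
      have h' : (4 / L + 3) * a = 4 * a / L + 3 * a := by ring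
      linarith
    have h2 : V * (2 * √(4 * a * C)) = 4 * V * √C * √a := by
      have : 4 * a * C = 2 ^ 2 * (C * a) := by ring
      rw [this, Real.sqrt_mul (by norm_num), Real.sqrt_sq (by norm_num), Real.sqrt_mul hC]
      ring
    have h3 : √(L * (2 * (a + C) + 5 * L)) ≤ √(L * (4 + 5 * L)) * √a := by
      rw [← Real.sqrt_mul (by positivity)]
      refine Real.sqrt_le_sqrt ?_
      rw [mul_assoc]
      gcongr
      nlinarith
    have h4 : 2 * C + L ≤ (2 * C + L) * √a := le_mul_of_one_le_right (by positivity) hs1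
    have h5 : (2 * (a + C) / L + 3) *
        (V * (2 * √(4 * a * C)) + (2 * C + L + √(L * (2 * (a + C) + 5 * L)))) ≤ κ * (a * √a) := by
      calc _ ≤ ((4 / L + 3) * a) * (4 * V * √C * √a +
            ((2 * C + L) * √a + √(L * (4 + 5 * L)) * √a)) := by
            rw [h2]
            gcongr
        _ = _ := by rw [hκ]; ring
    have hfin : h.trajectorySet.lengthInBall a x ≠ ⊤ :=
      ((h.lengthInBall_le ha0 x).trans_lt ENNReal.ofReal_lt_top).ne
    have htop : h.trajectorySet.lengthInBall a x + ((κ * (a * √a)).toNNReal : ℝ≥0∞) ≠ ⊤ := by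
      finiteness
    obtain ⟨α, hα, -, -, hv, hS⟩ := ht.pad (hl.trans (by
      gcongr
      exact ENNReal.ofReal_le_ofReal h5)) htop
    exact ⟨α, hα, by rw [hv]; exact htop, hv, hS⟩

end NearHorizontal

/-! ### Lipschitz curves through all the clusters of a row -/

lemma exists_lipschitzWith_interpolation {ι : Type*} {s v : ι → ℝ} {K : ℝ≥0}
    (h : ∀ i j, |v i - v j| ≤ K * |s i - s j|) :
    ∃ g : ℝ → ℝ, LipschitzWith K g ∧ ∀ i, g (s i) = v i := by
  have hfac : v.FactorsThrough s := by
    intro i j hij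
    have := h i j
    rw [hij, sub_self, abs_zero, mul_zero] at this
    exact sub_eq_zero.1 (abs_nonpos_iff.1 this)
  have hlip : LipschitzOnWith K (s.extend v 0) (Set.range s) := by
    refine LipschitzOnWith.of_dist_le_mul ?_
    rintro _ ⟨i, rfl⟩ _ ⟨j, rfl⟩
    rw [hfac.extend_apply, hfac.extend_apply]
    exact h i j
  obtain ⟨g, hg, hgs⟩ := hlip.extend_real
  exact ⟨g, hg, fun i => by rw [← hgs ⟨i, rfl⟩, hfac.extend_apply]⟩

/-- The position of a node in the lexicographic enumeration of a cluster. -/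
def nodeIndex (K : ℕ) (p : ℕ × ℕ) : ℤ := ((K + 1 : ℕ) : ℤ) * p.1 + p.2

/-- Distinct nodes have distinct indices, and then the right side is at least `K + 1` while
coordinates differ by at most `K`. This is why `nodeTime` stretches the index by `K + 1`:
displacement within a cluster never exceeds the elapsed time. -/
lemma abs_sub_le_nodeIndex {K : ℕ} {p p' : ℕ × ℕ} (hp : p ∈ nodes K) (hp' : p' ∈ nodes K) :
    |(p.1 : ℤ) - p'.1| ≤ (K + 1) * |nodeIndex K p - nodeIndex K p'| ∧
      |(p.2 : ℤ) - p'.2| ≤ (K + 1) * |nodeIndex K p - nodeIndex K p'| := by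
  simp only [nodes, Finset.mem_product, Finset.mem_range] at hp hp'
  by_cases h : nodeIndex K p = nodeIndex K p'
  · obtain ⟨h1, h2⟩ := eq_of_mul_add_eq hp.2 hp'.2 h
    simp [h, h1, h2]
  · have h1 := Int.one_le_abs (sub_ne_zero.2 h)
    have h2 : (K + 1 : ℤ) ≤ (K + 1) * |nodeIndex K p - nodeIndex K p'| :=
      le_mul_of_one_le_right (by positivity) h1
    constructor <;> refine le_trans ?_ h2 <;> rw [abs_le] <;> omega

/-- The time at which a curve passes through a node. -/
noncomputable def nodeTime (L q K : ℕ) (i : ℤ × nodes K) : ℝ :=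
  L * i.1 + (K + 1) * nodeIndex K i.2 / q

/-- Here `d` is the time between two clusters, `σ` the time offset within clusters and `δ` the
displacement there. Either the cluster column is the same, or `|d| ≥ 1` dominates both small terms.
-/
lemma abs_add_le_two_mul {d σ δ : ℝ} (hd : d = 0 ∨ 1 ≤ |d|) (hσ : |σ| ≤ 1 / 4) (hδ : |δ| ≤ |σ|) :
    |d + δ| ≤ 2 * |d + σ| ∧ |δ| ≤ 2 * |d + σ| := by
  rcases hd with rfl | hd
  · simp only [zero_add]
    constructor <;> linarith [abs_nonneg σ]
  · have h1 := abs_add_le d δ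
    have h2 : |d| ≤ |d + σ| + |σ| := by simpa using abs_sub (d + σ) σ
    constructor <;> linarith

lemma abs_node_sub_le {L q K : ℕ} (hq : 4 * (K + 1) ^ 3 ≤ q) (i j : ℤ × nodes K) :
    |(L * i.1 + i.2.1.1 / q : ℝ) - (L * j.1 + j.2.1.1 / q)| ≤
        2 * |nodeTime L q K i - nodeTime L q K j| ∧
      |(i.2.1.2 / q : ℝ) - j.2.1.2 / q| ≤ 2 * |nodeTime L q K i - nodeTime L q K j| := by
  obtain ⟨n, p, hp⟩ := i
  obtain ⟨n', p', hp'⟩ := j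
  have hq0 : (0 : ℝ) < q := by
    have : 0 < 4 * (K + 1) ^ 3 := by positivity
    exact_mod_cast this.trans_le hq
  have hqR : (4 * (K + 1) ^ 3 : ℝ) ≤ q := by exact_mod_cast hq
  obtain ⟨h1, h2⟩ := abs_sub_le_nodeIndex hp hp'
  have h1' : |(p.1 : ℝ) - p'.1| ≤ (K + 1) * |(nodeIndex K p : ℝ) - nodeIndex K p'| := by
    exact_mod_cast h1
  have h2' : |(p.2 : ℝ) - p'.2| ≤ (K + 1) * |(nodeIndex K p : ℝ) - nodeIndex K p'| := by
    exact_mod_cast h2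
  set σ : ℝ := (K + 1) * ((nodeIndex K p : ℝ) - nodeIndex K p') / q with hσ
  have hσabs : |σ| = (K + 1) * |(nodeIndex K p : ℝ) - nodeIndex K p'| / q := by
    rw [hσ, abs_div, abs_mul, abs_of_pos hq0, abs_of_nonneg (by positivity : (0 : ℝ) ≤ K + 1)]
  have hidx : |(nodeIndex K p : ℝ) - nodeIndex K p'| ≤ (K + 1) ^ 2 := by
    simp only [nodes, Finset.mem_product, Finset.mem_range] at hp hp'
    have hb : ∀ p : ℕ × ℕ, (p.1 < K + 1 ∧ p.2 < K + 1) →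
        (0 : ℝ) ≤ nodeIndex K p ∧ (nodeIndex K p : ℝ) ≤ (K + 1) ^ 2 := by
      intro p hp
      have ha : (p.1 : ℝ) ≤ K := by exact_mod_cast Nat.lt_succ_iff.1 hp.1
      have hb : (p.2 : ℝ) ≤ K := by exact_mod_cast Nat.lt_succ_iff.1 hp.2
      have hc : (0 : ℝ) ≤ p.1 := Nat.cast_nonneg _
      simp only [nodeIndex]
      push_cast
      constructor
      · positivity
      · nlinarith
    have ha := hb p hp
    have hb := hb p' hp'
    rw [abs_le]
    constructor <;> linarith
  -- Index differences are at most `(K + 1)²`, so offsets are at most `(K + 1)³ / q`; this is where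
  -- `4 (K + 1)³ ≤ q` enters.
  have hσ4 : |σ| ≤ 1 / 4 := by
    rw [hσabs, div_le_iff₀ hq0]
    calc (K + 1 : ℝ) * |(nodeIndex K p : ℝ) - nodeIndex K p'| ≤ (K + 1) * (K + 1) ^ 2 := by gcongr
      _ ≤ 1 / 4 * q := by linarith
  have hd : (L * ((n : ℝ) - n') : ℝ) = 0 ∨ 1 ≤ |(L * ((n : ℝ) - n') : ℝ)| := by
    have : (L * ((n : ℝ) - n') : ℝ) = ((L * (n - n') : ℤ) : ℝ) := by push_cast; ring
    rw [this, ← Int.cast_abs]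
    rcases eq_or_ne ((L : ℤ) * (n - n')) 0 with h | h
    · left; rw [h]; simp
    · right; exact_mod_cast Int.one_le_abs h
  have ht : nodeTime L q K (n, ⟨p, hp⟩) - nodeTime L q K (n', ⟨p', hp'⟩) =
      L * ((n : ℝ) - n') + σ := by
    simp only [nodeTime, hσ]; ring
  have hδ : ∀ a b : ℕ, |(a : ℝ) - b| ≤ (K + 1) * |(nodeIndex K p : ℝ) - nodeIndex K p'| →
      |((a : ℝ) - b) / q| ≤ |σ| := by
    intro a b hab
    rw [abs_div, abs_of_pos hq0, hσabs]
    gcongr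
  rw [ht]
  constructor
  · convert (abs_add_le_two_mul hd hσ4 (hδ _ _ h1')).1 using 2
    ring
  · convert (abs_add_le_two_mul hd hσ4 (hδ _ _ h2')).2 using 2
    ring

/-- Sets of small clusters lie on nearly horizontal curves. -/
theorem exists_nearHorizontal_sampleSet_subset {L q K : ℕ} (hL : 0 < L)
    (hq : 4 * (K + 1) ^ 3 ≤ q) :
    ∃ (γ : ℤ → ℝ → Euc 2) (h : NearHorizontal γ L (5 * L) 3),
      sampleSet L q K ⊆ h.trajectorySet.points := by
  have hLR : (0 : ℝ) < L := by exact_mod_cast hL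
  obtain ⟨g₁, hg₁, hv₁⟩ := exists_lipschitzWith_interpolation (K := 2)
    fun i j => (abs_node_sub_le hq i j).1
  obtain ⟨g₂, hg₂, hv₂⟩ := exists_lipschitzWith_interpolation (K := 2)
    fun i j => (abs_node_sub_le hq i j).2
  have hdist₁ : ∀ s t, |g₁ s - g₁ t| ≤ 2 * |s - t| := fun s t => hg₁.dist_le_mul s t
  have hdist₂ : ∀ s t, |g₂ s - g₂ t| ≤ 2 * |s - t| := fun s t => hg₂.dist_le_mul s t
  have hzero : ((0, 0) : ℕ × ℕ) ∈ nodes K := by simp [nodes]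
  have hlat : ∀ n : ℤ, g₁ (L * n) = L * n ∧ g₂ (L * n) = 0 := by
    intro n
    have h1 := hv₁ (n, ⟨(0, 0), hzero⟩)
    have h2 := hv₂ (n, ⟨(0, 0), hzero⟩)
    simpa [nodeTime, nodeIndex] using And.intro h1 h2
  -- All rows are vertical translates of one curve. Its coordinates are 2-Lipschitz, and `√8 ≤ 3`;
  -- the offsets `3L` and `2L` found below give distance at most `√13 L ≤ 5L`.
  refine ⟨fun m t => !₂[g₁ t, L * m + g₂ t], ⟨hLR, by positivity, fun m => ?_, fun m t => ?_⟩, ?_⟩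
  · refine LipschitzWith.of_dist_le_mul fun s t => ?_
    refine (pow_le_pow_iff_left₀ dist_nonneg (by positivity) two_ne_zero).1 ?_
    rw [dist_pair_sq]
    have h1 : (g₁ s - g₁ t) ^ 2 ≤ (2 * |s - t|) ^ 2 := by rw [← sq_abs]; gcongr; exact hdist₁ s t
    have h2 : (g₂ s - g₂ t) ^ 2 ≤ (2 * |s - t|) ^ 2 := by rw [← sq_abs]; gcongr; exact hdist₂ s t
    simp only [Matrix.cons_val_zero, Matrix.cons_val_one, add_sub_add_left_eq_sub, Real.dist_eq,
      NNReal.coe_ofNat]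
    nlinarith [sq_nonneg |s - t|]
  · set n := ⌊t / L⌋
    have hn1 : |t - L * n| ≤ L := by
      have h1 := Int.floor_le (t / L)
      have h2 := Int.lt_floor_add_one (t / L)
      rw [le_div_iff₀ hLR] at h1
      rw [div_lt_iff₀ hLR] at h2
      rw [abs_le]
      constructor <;> nlinarith
    have h1 : |g₁ t - t| ≤ 3 * L := by
      have h1 := hdist₁ t (L * n)
      rw [(hlat n).1] at h1
      have h2 := abs_sub_le (g₁ t) (L * n) t
      rw [abs_sub_comm (L * n : ℝ) t] at h2
      linarith
    have h2 : |g₂ t| ≤ 2 * L := by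
      have h1 := hdist₂ t (L * n)
      rw [(hlat n).2, sub_zero] at h1
      linarith
    refine (pow_le_pow_iff_left₀ dist_nonneg (by positivity) two_ne_zero).1 ?_
    rw [dist_pair_sq]
    have h1' : (g₁ t - t) ^ 2 ≤ (3 * L) ^ 2 := by rw [← sq_abs]; gcongr
    have h2' : g₂ t ^ 2 ≤ (2 * L) ^ 2 := by rw [← sq_abs]; gcongr
    simp only [Matrix.cons_val_zero, Matrix.cons_val_one, add_sub_cancel_left]
    nlinarith
  · rintro x ⟨n, p, hp, rfl⟩
    refine Set.mem_iUnion.2 ⟨n 1, nodeTime L q K (n 0, ⟨p, hp⟩), ?_⟩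
    change !₂[g₁ _, L * (n 1 : ℝ) + g₂ _] = _
    rw [hv₁, hv₂]
    ext i
    fin_cases i <;> simp [clusterPoint, div_eq_mul_inv]

/-! ### Choice of parameters and conclusion -/

/-- Stable Nyquist trajectory sets of arbitrarily small path density. -/
theorem exists_mem_nyq_upperPathDensity_lt {Ω : Set (Euc 2)} (hΩ : IsCompact Ω) {ε : ℝ}
    (hε : 0 < ε) : ∃ P ∈ Nyq Ω, P.upperPathDensity < ENNReal.ofReal ε := by
  -- `84 = 28 * 3`, with 3 the Lipschitz constant. The spacing `L` is fixed first, then `K`, and the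
  -- mesh `1 / q` last.
  obtain ⟨L, hL⟩ := exists_nat_gt (84 / ε)
  have hLR : (0 : ℝ) < L := (by positivity : 0 < 84 / ε).trans hL
  have hL0 : 0 < L := by exact_mod_cast hLR
  obtain ⟨K, q₀, hK⟩ := exists_isStableSampling_sampleSet hΩ hL0
  set q := max q₀ (4 * (K + 1) ^ 3)
  have hq : 4 * (K + 1) ^ 3 ≤ q := le_max_right _ _
  have hq0 : 0 < q := (by positivity : 0 < 4 * (K + 1) ^ 3).trans_le hq
  obtain ⟨γ, h, hsub⟩ := exists_nearHorizontal_sampleSet_subset hL0 hq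
  refine ⟨h.trajectorySet, ⟨⟨sampleSet L q K, hsub, uniformlyDiscrete_sampleSet hq0,
    hK q (le_max_left _ _)⟩, h.nonDegenerate⟩, h.upperPathDensity_le.trans_lt ?_⟩
  rw [ENNReal.ofReal_lt_ofReal_iff hε, div_lt_iff₀ hLR]
  rw [div_lt_iff₀ hε] at hL
  push_cast
  linarith

end MobileSampling

theorem mainTheorem3 (Ω : Set (MobileSampling.Euc 2)) (hΩ : IsCompact Ω) :
    (∀ ε : ℝ, 0 < ε →
      ∃ P ∈ MobileSampling.Nyq Ω, P.upperPathDensity < ENNReal.ofReal ε) ∧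
    (⨅ P ∈ MobileSampling.Nyq Ω, P.upperPathDensity) = 0 := by
  have h : ∀ ε : ℝ, 0 < ε →
      ∃ P ∈ MobileSampling.Nyq Ω, P.upperPathDensity < ENNReal.ofReal ε :=
    fun ε hε => MobileSampling.exists_mem_nyq_upperPathDensity_lt hΩ hε
  refine ⟨h, le_antisymm (ENNReal.le_of_forall_pos_le_add fun ε hε _ => ?_) bot_le⟩
  obtain ⟨P, hP, hlt⟩ := h ε hε
  rw [ENNReal.ofReal_coe_nnreal] at hlt
  exact (iInf₂_le P hP).trans (hlt.le.trans (by simp))
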